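/- Work in $\mathbb{F}_2[x]$. A nonzero polynomial is even if it has a linear factor, and odd otherwise; it splits if it is even and has at most two distinct irreducible factors. Let $\sigma(A)$ be the sum of all divisors of $A\neq 0$. Call $A\ne 0$ perfect if $\sigma(A)=A$, and indecomposable perfect if it is perfect and is not a product of two coprime nonconstant perfect polynomials. Let $\overline{Q}(x)=Q(x+1)$. Put $M_1=1+x+x^2$, $M_2=1+x+x^3$, $M_3=\overline{M_2}=1+x^2+x^3$, $M_4=1+x+x^2+x^3+x^4$, $M_5=\overline{M_4}=1+x^3+x^4$, $M_6=1+x^3+x^5$, $M_7=1+x^3+x^7$, $M_8=1+x^6+x^7$, $M_9=\overline{M_6}$, $M_{10}=\overline{M_7}$, $M_{11}=\overline{M_8}$, $M_{12}=x^9+x+1$, $M_{13}=\overline{M_{12}}=x^9+x^8+1$. With $[a,b,c]:=1+x^a(x+1)^bM_1^c$, put $S_1=[1,1,1]$, $S_2=[2,2,1]$, $S_3=[1,3,4]$, $S_4=[3,1,1]$, $S_5=[1,3,1]$, $S_6=[3,1,4]$, $S_7=[1,1,3]$, $S_8=[3,3,1]$, $S_9=[1,1,5]$, $S_{10}=[4,1,1]$,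 $S_{11}=[1,2,1]$, $S_{12}=[2,1,2]$, $S_{13}=[1,4,1]$, $S_{14}=[2,1,1]$, $S_{15}=[1,2,2]$. Let $\mathcal{F}=\{M_1,\dots,M_{13},S_1,\dots,S_{15}\}$. Finally put $T_1=x^2(x+1)M_1$, $T_2=\overline{T_1}$, $T_3=x^4(x+1)^3M_4$, $T_4=\overline{T_3}$, $T_5=x^4(x+1)^4M_4\overline{M_4}$, $T_6=x^6(x+1)^3M_2\overline{M_2}$, $T_7=\overline{T_6}$, $T_8=x^4(x+1)^6M_2\overline{M_2}M_4$, $T_9=\overline{T_8}$, $T_{10}=x^2(x+1)M_1^2(1+x+x^4)$, $T_{11}=\overline{T_{10}}$. **Theorem.** Let $A\in\mathbb{F}_2[x]$ be a nonzero, even, non-splitting polynomial all of whose odd irreducible divisors lie in $\mathcal{F}$. Then $A$ is indecomposable perfect if and only if $A,\overline{A}\in\{T_1,\dots,T_{11}\}$. -/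

import Mathlib

open scoped Polynomial

namespace BinaryPoly

noncomputable section

/-- A binary polynomial is even if it has a linear factor. -/
def IsEven (A : (ZMod 2)[X]) : Prop :=
  ∃ L : (ZMod 2)[X], L.degree = 1 ∧ L ∣ A

/-- A binary polynomial is odd if it is not even. -/
def IsOdd (A : (ZMod 2)[X]) : Prop := ¬ IsEven A

/-- The number of distinct irreducible factors of a nonzero `A`. As the only unit of
`(ZMod 2)[X]` is `1`, there are no distinct associated factors. -/
def omega (A : (ZMod 2)[X]) : ℕ :=
  Set.ncard {P : (ZMod 2)[X] | Irreducible P ∧ P ∣ A}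

/-- The sum of all divisors of a nonzero `A` (see `finite_divisors`). -/
def sigma (A : (ZMod 2)[X]) : (ZMod 2)[X] :=
  ∑ᶠ D ∈ {D : (ZMod 2)[X] | D ∣ A}, D

/-- A nonzero polynomial has finitely many divisors, so `sigma` is a genuine finite sum. -/
theorem finite_divisors {A : (ZMod 2)[X]} (hA : A ≠ 0) :
    {D : (ZMod 2)[X] | D ∣ A}.Finite := by
  refine Set.Finite.of_finite_image
    (f := fun (D : (ZMod 2)[X]) (i : Fin (A.natDegree + 1)) => D.coeff i) (Set.toFinite _) ?_
  intro D hD E hE h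
  ext n
  by_cases hn : n < A.natDegree + 1
  · exact congrFun h ⟨n, hn⟩
  · have h1 := Polynomial.natDegree_le_of_dvd hD hA
    have h2 := Polynomial.natDegree_le_of_dvd hE hA
    rw [Polynomial.coeff_eq_zero_of_natDegree_lt (by omega),
      Polynomial.coeff_eq_zero_of_natDegree_lt (by omega)]

/-- `A` splits if it is even and has at most two distinct irreducible factors. -/
def IsSplitting (A : (ZMod 2)[X]) : Prop := IsEven A ∧ omega A ≤ 2

/-- A nonzero polynomial is perfect if it equals the sum of its divisors. -/
def IsPerfect (A : (ZMod 2)[X]) : Prop := A ≠ 0 ∧ sigma A = A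

/-- A perfect polynomial that is not the product of two coprime nonconstant perfect
polynomials. -/
def IsIndecomposablePerfect (A : (ZMod 2)[X]) : Prop :=
  IsPerfect A ∧
    ¬ ∃ B C : (ZMod 2)[X], IsPerfect B ∧ IsPerfect C ∧ 0 < B.natDegree ∧ 0 < C.natDegree ∧
      IsCoprime B C ∧ A = B * C

/-- The indeterminate `x`. -/
def x : (ZMod 2)[X] := Polynomial.X

/-- The polynomial obtained from `Q` by substituting `x + 1` for `x`. -/
def bar (Q : (ZMod 2)[X]) : (ZMod 2)[X] := Q.comp (x + 1)

/-- The polynomial `1 + x ^ a * (x + 1) ^ b * Q ^ c`. -/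
def angle (Q : (ZMod 2)[X]) (a b c : ℕ) : (ZMod 2)[X] := 1 + x ^ a * (x + 1) ^ b * Q ^ c

def M1 : (ZMod 2)[X] := 1 + x + x ^ 2
def M2 : (ZMod 2)[X] := 1 + x + x ^ 3
def M3 : (ZMod 2)[X] := 1 + x ^ 2 + x ^ 3
def M4 : (ZMod 2)[X] := 1 + x + x ^ 2 + x ^ 3 + x ^ 4
def M5 : (ZMod 2)[X] := 1 + x ^ 3 + x ^ 4
def M6 : (ZMod 2)[X] := 1 + x ^ 3 + x ^ 5
def M7 : (ZMod 2)[X] := 1 + x ^ 3 + x ^ 7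
def M8 : (ZMod 2)[X] := 1 + x ^ 6 + x ^ 7
def M9 : (ZMod 2)[X] := bar M6
def M10 : (ZMod 2)[X] := bar M7
def M11 : (ZMod 2)[X] := bar M8
def M12 : (ZMod 2)[X] := x ^ 9 + x + 1
def M13 : (ZMod 2)[X] := x ^ 9 + x ^ 8 + 1

def S1 : (ZMod 2)[X] := angle M1 1 1 1
def S2 : (ZMod 2)[X] := angle M1 2 2 1
def S3 : (ZMod 2)[X] := angle M1 1 3 4
def S4 : (ZMod 2)[X] := angle M1 3 1 1
def S5 : (ZMod 2)[X] := angle M1 1 3 1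
def S6 : (ZMod 2)[X] := angle M1 3 1 4
def S7 : (ZMod 2)[X] := angle M1 1 1 3
def S8 : (ZMod 2)[X] := angle M1 3 3 1
def S9 : (ZMod 2)[X] := angle M1 1 1 5
def S10 : (ZMod 2)[X] := angle M1 4 1 1
def S11 : (ZMod 2)[X] := angle M1 1 2 1
def S12 : (ZMod 2)[X] := angle M1 2 1 2
def S13 : (ZMod 2)[X] := angle M1 1 4 1
def S14 : (ZMod 2)[X] := angle M1 2 1 1
def S15 : (ZMod 2)[X] := angle M1 1 2 2

/-- The family `{M1, …, M13}`. -/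
def family1 : Set (ZMod 2)[X] :=
  {M1, M2, M3, M4, M5, M6, M7, M8, M9, M10, M11, M12, M13}

/-- The family `{S1, …, S15}`. -/
def family2 : Set (ZMod 2)[X] :=
  {S1, S2, S3, S4, S5, S6, S7, S8, S9, S10, S11, S12, S13, S14, S15}

/-- The family of all `Mi` and `Sj`. -/
def family : Set (ZMod 2)[X] := family1 ∪ family2

def T1 : (ZMod 2)[X] := x ^ 2 * (x + 1) * M1
def T2 : (ZMod 2)[X] := bar T1
def T3 : (ZMod 2)[X] := x ^ 4 * (x + 1) ^ 3 * M4
def T4 : (ZMod 2)[X] := bar T3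
def T5 : (ZMod 2)[X] := x ^ 4 * (x + 1) ^ 4 * M4 * bar M4
def T6 : (ZMod 2)[X] := x ^ 6 * (x + 1) ^ 3 * M2 * bar M2
def T7 : (ZMod 2)[X] := bar T6
def T8 : (ZMod 2)[X] := x ^ 4 * (x + 1) ^ 6 * M2 * bar M2 * M4
def T9 : (ZMod 2)[X] := bar T8
def T10 : (ZMod 2)[X] := x ^ 2 * (x + 1) * M1 ^ 2 * (1 + x + x ^ 4)
def T11 : (ZMod 2)[X] := bar T10

/-- The eleven polynomials `T1, …, T11`. -/
def knownPerfects : Set (ZMod 2)[X] :=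
  {T1, T2, T3, T4, T5, T6, T7, T8, T9, T10, T11}

end

end BinaryPoly

/-! The irreducible divisors of A lie among thirty explicit polynomials P: x, x + 1 and the 28
members of `family`. Write A = ∏ P^e with e + 1 = 2^n u and u odd. Multiplicativity of σ and the
Frobenius map give σ(P^e) = (P + 1)^(2^n - 1) G^(2^n) with G = 1 + P + ⋯ + P^(u - 1), so σ(A) = A
becomes a system of equations for the exponents.

G divides A, so it also factors over the thirty polynomials. For a prime p dividing u, an
irreducible factor Q of the sum of length p satisfies p ∣ 2^(deg Q) - 1, which leaves eight primes;
excluding a finite list of divisors then leaves a short list of values of u for each P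
(`mem_options`). All factors of P + 1 and of G are now explicit (`exponent_system`).

The numbers n are still unbounded. Since e + 1 is divisible by 2^n, the binary expansion of e ends
in n ones, whereas a sum of k powers of two has at most k ones. Most equations express e as a short
sum of powers of two, hence bound n (`le_length_of_sum_gate`). The three remaining polynomials x, x
+ 1 and M1 are bounded by comparing their equations (`trivial_or_bounded`), apart from the family
(x(x + 1))^(2^k - 1), which splits. A finite search leaves exactly the exponents of T1, …, T11.

Conversely, the eleven polynomials are checked to be perfect. By the classification every
nonconstant perfect polynomial over these primes is divisible by x, so two of them are never coprime
and indecomposability follows. -/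

namespace BinaryPoly

open Polynomial UniqueFactorizationMonoid

/-! ### Arithmetic of binary polynomials on their digit codes -/

/-- The binary polynomial whose coefficients are the binary digits of `n`. -/
noncomputable def ofBits (n : ℕ) : (ZMod 2)[X] :=
  ∑ i ∈ Finset.range n, if n.testBit i then Polynomial.X ^ i else 0

theorem coeff_ofBits (n i : ℕ) : (ofBits n).coeff i = if n.testBit i then 1 else 0 := by
  have h1 : ∀ j, ((if n.testBit j then X ^ j else 0 : (ZMod 2)[X])).coeff i
      = if i = j then (if n.testBit i then 1 else 0) else 0 := by
    intro j
    by_cases hij : i = j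
    · subst hij
      by_cases hb : n.testBit i <;> simp [hb]
    · by_cases hb : n.testBit j <;> simp [hb, coeff_X_pow, hij]
  simp only [ofBits, finsetSum_coeff, h1, Finset.sum_ite_eq, Finset.mem_range]
  by_cases hi : i < n
  · simp [hi]
  · have : n.testBit i = false :=
      Nat.testBit_lt_two_pow ((not_lt.mp hi).trans_lt i.lt_two_pow_self)
    simp [this]

theorem ofBits_injective : Function.Injective ofBits := by
  intro m n h
  refine Nat.eq_of_testBit_eq fun i => ?_
  have := congrArg (fun p => Polynomial.coeff p i) h
  simp only [coeff_ofBits] at this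
  cases hm : m.testBit i <;> cases hn : n.testBit i <;> simp [hm, hn] at this ⊢

theorem ofBits_xor (m n : ℕ) : ofBits (m ^^^ n) = ofBits m + ofBits n := by
  ext i
  simp only [coeff_ofBits, coeff_add, Nat.testBit_xor]
  cases m.testBit i <;> cases n.testBit i <;> simp
  decide

theorem ofBits_shiftLeft (n k : ℕ) : ofBits (n <<< k) = X ^ k * ofBits n := by
  ext i
  simp only [coeff_ofBits, coeff_X_pow_mul', Nat.testBit_shiftLeft]
  by_cases h : k ≤ i <;> simp [h]

@[simp] theorem ofBits_zero : ofBits 0 = 0 := by ext i; simp [coeff_ofBits]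

@[simp] theorem ofBits_one : ofBits 1 = 1 := by
  ext i
  rcases i with _ | i <;> simp [coeff_ofBits, coeff_one, Nat.testBit_succ]

theorem ofBits_two : ofBits 2 = X := by
  have := ofBits_shiftLeft 1 1
  simpa using this

theorem ofBits_three : ofBits 3 = X + 1 := by
  have := ofBits_xor 2 1
  rwa [ofBits_two, ofBits_one] at this

theorem ofBits_eq_zero {n : ℕ} : ofBits n = 0 ↔ n = 0 := by
  rw [← ofBits_zero, ofBits_injective.eq_iff]

theorem ofBits_eq_one {n : ℕ} : ofBits n = 1 ↔ n = 1 := by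
  rw [← ofBits_one, ofBits_injective.eq_iff]

theorem ofBits_surjective : Function.Surjective ofBits := by
  intro p
  induction p using Polynomial.induction_on' with
  | add p q hp hq =>
    obtain ⟨m, rfl⟩ := hp
    obtain ⟨n, rfl⟩ := hq
    exact ⟨_, ofBits_xor m n⟩
  | monomial n a =>
    rcases (show a = 0 ∨ a = 1 by revert a; decide) with rfl | rfl
    · exact ⟨0, by simp⟩
    · exact ⟨1 <<< n, by rw [ofBits_shiftLeft, ofBits_one, mul_one, ← monomial_one_right_eq_X_pow]⟩

theorem degree_ofBits_lt {n k : ℕ} : (ofBits n).degree < k ↔ n < 2 ^ k := by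
  rw [degree_lt_iff_coeff_zero]
  constructor
  · intro h
    refine Nat.lt_pow_two_of_testBit _ fun i hi => ?_
    have := h i hi
    rw [coeff_ofBits] at this
    cases hb : n.testBit i
    · rfl
    · simp [hb] at this
  · intro h i hi
    rw [coeff_ofBits, Nat.testBit_lt_two_pow (h.trans_le (Nat.pow_le_pow_right two_pos hi))]
    rfl

theorem natDegree_ofBits (n : ℕ) : (ofBits n).natDegree = n.log2 := by
  rcases Nat.eq_zero_or_pos n with rfl | hn
  · simp
  · have h0 : ofBits n ≠ 0 := fun h => hn.ne' (ofBits_eq_zero.mp h)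
    refine eq_of_forall_lt_iff fun k => ?_
    rw [← not_le, ← not_le, not_iff_not, ← Nat.lt_succ_iff, ← Nat.lt_succ_iff, Nat.log2_lt hn.ne',
      ← degree_ofBits_lt, degree_eq_natDegree h0, Nat.cast_lt]

theorem ofBits_mod_two_mul (b a : ℕ) :
    ofBits (b % 2 * a) = ofBits (b % 2) * ofBits a := by
  rcases Nat.mod_two_eq_zero_or_one b with h | h <;> simp [h]

theorem ofBits_eq_mod_add_div (b : ℕ) :
    ofBits b = ofBits (b % 2) + X * ofBits (b / 2) := by
  ext i
  rcases i with _ | i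
  · simp [coeff_ofBits, mul_coeff_zero]
  · have h : b % 2 / 2 = 0 := by omega
    simp [coeff_ofBits, coeff_X_mul, Nat.testBit_succ, h]

/-- Carry-less multiplication by the lowest `f` digits of the second factor. -/
def mulAux : ℕ → ℕ → ℕ → ℕ
  | 0, _, _ => 0
  | f + 1, a, b => (b % 2 * a) ^^^ mulAux f (a <<< 1) (b / 2)

theorem ofBits_mulAux (f a b : ℕ) (h : b < 2 ^ f) :
    ofBits (mulAux f a b) = ofBits a * ofBits b := by
  induction f generalizing a b with
  | zero => obtain rfl : b = 0 := by simpa using h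
            simp [mulAux]
  | succ f ih =>
    rw [mulAux, ofBits_xor, ih _ _ (by rw [pow_succ] at h; omega), ofBits_shiftLeft,
      ofBits_mod_two_mul]
    conv_rhs => rw [ofBits_eq_mod_add_div b]
    ring

/-- Carry-less multiplication. -/
def mulBits (a b : ℕ) : ℕ := mulAux (b.log2 + 1) a b

theorem ofBits_mulBits (a b : ℕ) : ofBits (mulBits a b) = ofBits a * ofBits b :=
  ofBits_mulAux _ _ _ Nat.lt_log2_self

theorem ofBits_foldr (l : List ℕ) : ofBits (l.foldr mulBits 1) = (l.map ofBits).prod := by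
  induction l with
  | nil => simp
  | cons a l ih => simp [ofBits_mulBits, ih]

/-- Carry-less reduction of `a < 2 ^ (d + f)` modulo `q`, where `d` is the degree of `q`. -/
def modAux (q d : ℕ) : ℕ → ℕ → ℕ
  | 0, a => a
  | f + 1, a => modAux q d f (a ^^^ ((a >>> (d + f)) % 2 * (q <<< f)))

/-- In characteristic 2 the sum is a difference, so this is a congruence modulo `q`. No bound on the
remainder is proved: computations that need a reduced remainder check its size explicitly. -/
theorem dvd_ofBits_modAux (q d f a : ℕ) :
    ofBits q ∣ ofBits (modAux q d f a) + ofBits a := by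
  induction f generalizing a with
  | zero => simp [modAux, CharTwo.add_self_eq_zero]
  | succ f ih =>
    have h := ih (a ^^^ ((a >>> (d + f)) % 2 * (q <<< f)))
    rw [ofBits_xor, ofBits_mod_two_mul, ofBits_shiftLeft, ← add_assoc] at h
    exact (dvd_add_left (Dvd.intro_left _ (by rw [mul_assoc]))).mp h

/-- Carry-less remainder. -/
def modBits (a q : ℕ) : ℕ := modAux q q.log2 (a.log2 + 1 - q.log2) a

theorem dvd_ofBits_modBits (a q : ℕ) : ofBits q ∣ ofBits (modBits a q) + ofBits a :=
  dvd_ofBits_modAux _ _ _ _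


theorem dvd_of_modBits_eq_zero {a q : ℕ} (h : modBits a q = 0) : ofBits q ∣ ofBits a := by
  simpa [h] using dvd_ofBits_modBits a q

/-- Composition of the polynomial given by the lowest `f` digits of `g` with `p`. -/
def compAux (p : ℕ) : ℕ → ℕ → ℕ
  | 0, _ => 0
  | f + 1, g => (g % 2) ^^^ mulBits (compAux p f (g / 2)) p

theorem ofBits_compAux (p f g : ℕ) (h : g < 2 ^ f) :
    ofBits (compAux p f g) = (ofBits g).comp (ofBits p) := by
  induction f generalizing g with
  | zero => obtain rfl : g = 0 := by simpa using h
            simp [compAux]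
  | succ f ih =>
    rw [compAux, ofBits_xor, ofBits_mulBits, ih _ (by rw [pow_succ] at h; omega)]
    conv_rhs => rw [ofBits_eq_mod_add_div g]
    rcases Nat.mod_two_eq_zero_or_one g with h | h <;> simp [h, mul_comm]

/-- Composition of polynomials given by their digits. -/
def compBits (g p : ℕ) : ℕ := compAux p (g.log2 + 1) g

theorem ofBits_compBits (g p : ℕ) : ofBits (compBits g p) = (ofBits g).comp (ofBits p) :=
  ofBits_compAux _ _ _ Nat.lt_log2_self

theorem not_dvd_ofBits_of_lt {q r : ℕ} (h0 : r ≠ 0) (hr : r < 2 ^ q.log2) :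
    ¬ ofBits q ∣ ofBits r := by
  intro h1
  have hq : ofBits q ≠ 0 := by
    rintro hq
    rw [hq, zero_dvd_iff, ofBits_eq_zero] at h1
    exact h0 h1
  have h2 := degree_le_of_dvd h1 (fun h => h0 (ofBits_eq_zero.mp h))
  rw [degree_eq_natDegree hq, natDegree_ofBits] at h2
  exact absurd (degree_ofBits_lt.mpr hr) (not_lt.mpr h2)

theorem not_dvd_of_modBits {a q : ℕ} (h0 : modBits a q ≠ 0) (hr : modBits a q < 2 ^ q.log2) :
    ¬ ofBits q ∣ ofBits a :=
  fun hd => not_dvd_ofBits_of_lt h0 hr ((dvd_add_left hd).mp (dvd_ofBits_modBits a q))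

/-! ### Irreducibility of the thirty admissible polynomials -/

/-- Trial division of `c` by all polynomials `q` with `2 ≤ q < 2 ^ (d / 2 + 1)`, where `d` is the
degree of `c`. -/
def irredTest (c : ℕ) : Bool :=
  (List.range (2 ^ (c.log2 / 2 + 1))).all fun q =>
    Nat.blt q 2 || (!(modBits c q == 0) && Nat.blt (modBits c q) (2 ^ q.log2))

theorem isUnit_iff_eq_one {p : (ZMod 2)[X]} : IsUnit p ↔ p = 1 := by
  refine ⟨fun h => ?_, fun h => h ▸ isUnit_one⟩
  obtain ⟨r, hr, rfl⟩ := Polynomial.isUnit_iff.mp h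
  have : r = 1 := by
    have h0 := hr.ne_zero
    clear h hr
    revert h0; revert r; decide
  rw [this, C_1]

/-- In a product of two polynomials one factor has at most half the degree, so trial division up to
that degree suffices. -/
theorem irreducible_of_irredTest {c : ℕ} (hc : 2 ≤ c) (h : irredTest c = true) :
    Irreducible (ofBits c) := by
  have h0 : ofBits c ≠ 0 := by rw [Ne, ofBits_eq_zero]; omega
  have key : ∀ p r : (ZMod 2)[X], ofBits c = p * r → p.natDegree ≤ r.natDegree → p = 1 := by
    intro p r hpr hle
    obtain ⟨q, rfl⟩ := ofBits_surjective p
    have hp0 : ofBits q ≠ 0 := fun h => h0 (by rw [hpr, h, zero_mul])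
    have hr0 : r ≠ 0 := fun h => h0 (by rw [hpr, h, mul_zero])
    by_contra h1
    rw [ofBits_eq_one] at h1
    rw [Ne, ofBits_eq_zero] at hp0
    have hdeg := congrArg natDegree hpr
    rw [natDegree_mul (by rwa [Ne, ofBits_eq_zero]) hr0, natDegree_ofBits, natDegree_ofBits] at hdeg
    rw [natDegree_ofBits] at hle
    have hq : q < 2 ^ (c.log2 / 2 + 1) := (Nat.log2_lt hp0).mp (by omega)
    have ht := List.all_eq_true.mp h q (List.mem_range.mpr hq)
    have hq2 : Nat.blt q 2 = false := by
      rw [← Bool.not_eq_true, Nat.blt_eq]; omega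
    simp only [hq2, Bool.false_or, Bool.and_eq_true, Bool.not_eq_true', Nat.blt_eq,
      beq_eq_false_iff_ne] at ht
    exact not_dvd_of_modBits ht.1 ht.2 (hpr ▸ dvd_mul_right _ _)
  refine ⟨fun hu => ?_, fun p r hpr => ?_⟩
  · rw [isUnit_iff_eq_one, ofBits_eq_one] at hu
    omega
  · rcases le_total p.natDegree r.natDegree with hle | hle
    · exact Or.inl (isUnit_iff_eq_one.mpr (key p r hpr hle))
    · exact Or.inr (isUnit_iff_eq_one.mpr (key r p (by rw [hpr, mul_comm]) hle))

/-- The codes of `x`, `x + 1` and of the elements of the family. -/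
def codes : List ℕ :=
  [2, 3, 7, 11, 13, 31, 25, 41, 137, 193, 61, 241, 171, 515, 769, 19, 109, 8191, 73, 91, 6553, 379,
    361, 4915, 145, 55, 253, 239, 37, 131]

theorem irreducible_of_mem_codes {c : ℕ} (hc : c ∈ codes) : Irreducible (ofBits c) := by
  have h : codes.all (fun c => Nat.ble 2 c && irredTest c) = true := by decide +kernel
  have := List.all_eq_true.mp h c hc
  rw [Bool.and_eq_true, Nat.ble_eq] at this
  exact irreducible_of_irredTest this.1 this.2

/-! ### Multiplicities, and detecting irreducible factors outside the list -/

/-- Iterated squaring modulo `q`. -/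
def sqMod (q : ℕ) : ℕ → ℕ → ℕ
  | 0, a => a
  | k + 1, a => sqMod q k (modBits (mulBits a a) q)

theorem dvd_sqMod {q k a : ℕ} (h : ofBits q ∣ ofBits a ^ 2 ^ k) : ofBits q ∣ ofBits (sqMod q k a) := by
  induction k generalizing a with
  | zero => simpa [sqMod] using h
  | succ k ih =>
    refine ih ?_
    have h1 := dvd_ofBits_modBits (mulBits a a) q
    rw [ofBits_mulBits, ← pow_two] at h1
    have h2 : ofBits q ∣ (ofBits (modBits (mulBits a a) q) + ofBits a ^ 2) ^ 2 ^ k :=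
      h1.trans (dvd_pow_self _ (by positivity))
    rw [add_pow_char_pow, ← pow_mul, ← pow_succ'] at h2
    exact (dvd_add_left h).mp h2

/-- The product of all codes. -/
def codesProd : ℕ := codes.foldr mulBits 1

theorem ofBits_codesProd : ofBits codesProd = (codes.map ofBits).prod := ofBits_foldr codes

/-- A sufficient criterion for `r` to have an irreducible factor outside of `codes`. -/
def roughTest (r : ℕ) : Bool :=
  Nat.blt r (2 ^ 256) &&
    (!(sqMod r 8 (modBits codesProd r) == 0) &&
      Nat.blt (sqMod r 8 (modBits codesProd r)) (2 ^ r.log2))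

/-- All irreducible divisors of `A` are given by the codes. -/
def Smooth (A : (ZMod 2)[X]) : Prop :=
  ∀ P : (ZMod 2)[X], Irreducible P → P ∣ A → ∃ c ∈ codes, ofBits c = P

theorem Smooth.of_dvd {A B : (ZMod 2)[X]} (hA : Smooth A) (h : B ∣ A) : Smooth B :=
  fun P hP hd => hA P hP (hd.trans h)

open Classical in
/-- The exponent of the irreducible polynomial `ofBits c` in `A`. -/
noncomputable def val (c : ℕ) (A : (ZMod 2)[X]) : ℕ := (normalizedFactors A).count (ofBits c)

theorem eq_of_associated {p q : (ZMod 2)[X]} (h : Associated p q) : p = q := by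
  obtain ⟨u, rfl⟩ := h
  rw [isUnit_iff_eq_one.mp u.isUnit, mul_one]

theorem val_mul (c : ℕ) {A B : (ZMod 2)[X]} (hA : A ≠ 0) (hB : B ≠ 0) :
    val c (A * B) = val c A + val c B := by
  rw [val, normalizedFactors_mul hA hB, Multiset.count_add, val, val]

theorem val_one (c : ℕ) : val c 1 = 0 := by simp [val]

theorem val_pow (c n : ℕ) (A : (ZMod 2)[X]) : val c (A ^ n) = n * val c A := by
  rw [val, normalizedFactors_pow, Multiset.count_nsmul, val]

theorem val_prod (c : ℕ) {ι : Type*} (s : Finset ι) (f : ι → (ZMod 2)[X])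
    (hf : ∀ i ∈ s, f i ≠ 0) : val c (∏ i ∈ s, f i) = ∑ i ∈ s, val c (f i) := by
  classical
  induction s using Finset.induction_on with
  | empty => simp [val_one]
  | insert a s ha ih =>
    rw [Finset.prod_insert ha, Finset.sum_insert ha, val_mul c (hf a (by simp))
      (Finset.prod_ne_zero_iff.mpr fun i hi => hf i (by simp [hi])),
      ih fun i hi => hf i (by simp [hi])]

theorem val_ofBits (c : ℕ) {d : ℕ} (hd : d ∈ codes) :
    val c (ofBits d) = if c = d then 1 else 0 := by
  classical
  have h := normalizedFactors_irreducible (irreducible_of_mem_codes hd)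
  rw [eq_of_associated (normalize_associated (ofBits d))] at h
  rw [val, h, Multiset.count_singleton]
  simp [ofBits_injective.eq_iff]

theorem val_list_prod (c : ℕ) (l : List ℕ) (hl : ∀ d ∈ l, d ∈ codes) :
    val c (l.map ofBits).prod = l.count c := by
  induction l with
  | nil => simp [val_one]
  | cons a l ih =>
    have h0 : ∀ d ∈ a :: l, ofBits d ≠ 0 := fun d hd => (irreducible_of_mem_codes (hl d hd)).ne_zero
    rw [List.map_cons, List.prod_cons, val_mul c (h0 a (by simp)), ih fun d hd => hl d (by simp [hd]),
      val_ofBits c (hl a (by simp)), List.count_cons, add_comm]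
    · rcases eq_or_ne c a with rfl | h
      · simp
      · simp [h, h.symm]
    · simp only [ne_eq, List.prod_eq_zero_iff, List.mem_map, not_exists, not_and]
      exact fun d hd => h0 d (by simp [hd])

theorem Smooth.eq_prod {A : (ZMod 2)[X]} (hA : Smooth A) (h0 : A ≠ 0) :
    A = ∏ c ∈ codes.toFinset, ofBits c ^ val c A := by
  classical
  have h1 : (normalizedFactors A).prod = A := eq_of_associated (prod_normalizedFactors h0)
  have h2 := Finset.prod_multiset_count_of_subset (normalizedFactors A)
    (codes.toFinset.image ofBits) (by
      intro P hP
      rw [Multiset.mem_toFinset] at hP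
      obtain ⟨c, hc, rfl⟩ := hA P (irreducible_of_normalized_factor P hP)
        (dvd_of_mem_normalizedFactors hP)
      exact Finset.mem_image_of_mem _ (List.mem_toFinset.mpr hc))
  rw [h1, Finset.prod_image (fun a _ b _ h => ofBits_injective h)] at h2
  exact h2

theorem val_le_natDegree {A : (ZMod 2)[X]} (h0 : A ≠ 0) {c : ℕ} (hc : c ∈ codes) :
    val c A ≤ A.natDegree := by
  classical
  have hc' := irreducible_of_mem_codes hc
  have h : ofBits c ^ val c A ∣ A := by
    have h1 := Multiset.prod_dvd_prod_of_le
      (Multiset.le_count_iff_replicate_le.mp (le_refl (val c A)))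
    rw [Multiset.prod_replicate] at h1
    exact h1.trans (prod_normalizedFactors h0).dvd
  have h2 := natDegree_le_of_dvd h h0
  rw [natDegree_pow] at h2
  nlinarith [hc'.natDegree_pos]

theorem codes_nodup : codes.Nodup := by decide

theorem Smooth.dvd_codesProd_pow {A : (ZMod 2)[X]} (hA : Smooth A) (h0 : A ≠ 0) {n : ℕ}
    (hn : A.natDegree ≤ n) : A ∣ ofBits codesProd ^ n := by
  have h : ofBits codesProd ^ n = ∏ c ∈ codes.toFinset, ofBits c ^ n := by
    rw [ofBits_codesProd, ← List.prod_toFinset _ codes_nodup, Finset.prod_pow]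
  rw [h, hA.eq_prod h0]
  refine Finset.prod_dvd_prod_of_dvd _ _ fun c hc => pow_dvd_pow _ ?_
  exact (val_le_natDegree h0 (List.mem_toFinset.mp hc)).trans hn

theorem dvd_modBits_pow {a q k : ℕ} (h : ofBits q ∣ ofBits a ^ 2 ^ k) :
    ofBits q ∣ ofBits (modBits a q) ^ 2 ^ k := by
  have h1 : ofBits q ∣ (ofBits (modBits a q) + ofBits a) ^ 2 ^ k :=
    (dvd_ofBits_modBits a q).trans (dvd_pow_self _ (by positivity))
  rw [add_pow_char_pow] at h1
  exact (dvd_add_left h).mp h1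

/-- Multiplicities are at most the degree, here below 256, so a smooth `ofBits r` would divide the
256th power of the product of all codes. Eight modular squarings compute that power; a nonzero
reduced remainder is a contradiction. -/
theorem not_smooth_of_roughTest {r : ℕ} (h : roughTest r = true) : ¬ Smooth (ofBits r) := by
  intro hs
  simp only [roughTest, Bool.and_eq_true, Nat.blt_eq, Bool.not_eq_true', beq_eq_false_iff_ne] at h
  obtain ⟨h1, h2, h3⟩ := h
  have h0 : r ≠ 0 := by
    rintro rfl
    simp at h3
    exact h2 h3
  have hd := hs.dvd_codesProd_pow (mt ofBits_eq_zero.mp h0) (n := 2 ^ 8) (by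
    rw [natDegree_ofBits]
    have h4 : r.log2 < 256 := (Nat.log2_lt h0).mpr h1
    exact h4.le.trans (by norm_num))
  exact not_dvd_ofBits_of_lt h2 h3 (dvd_sqMod (dvd_modBits_pow hd))

/-! ### Geometric sums with all factors in the list -/

/-- The geometric sum `1 + P + ⋯ + P ^ (u - 1)`. -/
noncomputable def geom (u : ℕ) (P : (ZMod 2)[X]) : (ZMod 2)[X] := ∑ i ∈ Finset.range u, P ^ i

theorem ofBits_two_pow_sub_one (u : ℕ) : ofBits (2 ^ u - 1) = geom u X := by
  ext i
  simp [coeff_ofBits, geom, coeff_X_pow, Nat.testBit_two_pow_sub_one]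

theorem geom_X_comp (u : ℕ) (P : (ZMod 2)[X]) : (geom u X).comp P = geom u P := by
  simp [geom]

theorem geom_mul_sub_one (u : ℕ) (P : (ZMod 2)[X]) : geom u P * (P + 1) = P ^ u + 1 := by
  have := geom_sum_mul P u
  rwa [CharTwo.sub_eq_add, CharTwo.sub_eq_add] at this

theorem geom_dvd_geom {b u : ℕ} (h : b ∣ u) {P : (ZMod 2)[X]} (hP : P + 1 ≠ 0) :
    geom b P ∣ geom u P := by
  obtain ⟨w, rfl⟩ := h
  refine ⟨geom w (P ^ b), mul_right_cancel₀ hP ?_⟩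
  rw [geom_mul_sub_one, pow_mul, ← geom_mul_sub_one, ← geom_mul_sub_one b]
  ring

theorem ofBits_add_one_ne_zero {c : ℕ} (hc : c ∈ codes) : ofBits c + 1 ≠ 0 := by
  intro h
  have h1 : ofBits c = 1 := by
    rwa [← CharTwo.sub_eq_add, sub_eq_zero] at h
  exact (irreducible_of_mem_codes hc).not_isUnit (h1 ▸ isUnit_one)

/-- In the field with 2^(deg Q) elements obtained by adjoining a root of Q, the class of P has order
exactly p: its p-th power is 1, and it is not 1 itself because the sum would then be p = 1 instead
of 0. -/
theorem prime_dvd_of_irreducible_dvd_geom {Q P : (ZMod 2)[X]} (hQ : Irreducible Q) {p : ℕ}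
    (hp : p.Prime) (hp2 : p ≠ 2) (h : Q ∣ geom p P) : p ∣ 2 ^ Q.natDegree - 1 := by
  have : Fact (Irreducible Q) := ⟨hQ⟩
  have : Fact p.Prime := ⟨hp⟩
  have hR : AdjoinRoot.mk Q (geom p P) = 0 := AdjoinRoot.mk_eq_zero.mpr h
  set a := AdjoinRoot.mk Q P with ha
  have h1 : a ^ p = 1 := by
    have h2 := congrArg (AdjoinRoot.mk Q) (geom_sum_mul P p)
    rw [map_mul, show AdjoinRoot.mk Q (∑ i ∈ Finset.range p, P ^ i) = 0 from hR, zero_mul, map_sub,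
      map_pow, map_one] at h2
    exact (sub_eq_zero.mp h2.symm)
  have hne : a ≠ 1 := by
    intro h2
    have h3 : AdjoinRoot.mk Q (geom p P) = (p : AdjoinRoot Q) := by
      simp [geom, map_sum, map_pow, ← ha, h2]
    have h4 : (p : AdjoinRoot Q) = 1 := by
      have : ((p : ZMod 2)) = 1 := by
        rw [← Nat.cast_one, ZMod.natCast_eq_natCast_iff]
        exact (Nat.odd_iff.mp (hp.odd_of_ne_two hp2))
      rw [← map_natCast (algebraMap (ZMod 2) (AdjoinRoot Q)), this, map_one]
    rw [hR, h4] at h3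
    exact zero_ne_one h3
  have ha0 : a ≠ 0 := by
    rintro h2
    rw [h2, zero_pow hp.ne_zero] at h1
    exact zero_ne_one h1
  let pb := AdjoinRoot.powerBasis hQ.ne_zero
  have : Module.Finite (ZMod 2) (AdjoinRoot Q) := pb.finite
  have : Finite (AdjoinRoot Q) := Module.finite_of_finite (ZMod 2)
  have := Fintype.ofFinite (AdjoinRoot Q)
  have hcard : Fintype.card (AdjoinRoot Q) = 2 ^ Q.natDegree := by
    rw [Module.card_eq_pow_finrank (K := ZMod 2), ZMod.card, pb.finrank, AdjoinRoot.powerBasis_dim]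
  have h5 := FiniteField.pow_card_sub_one_eq_one a ha0
  rw [hcard] at h5
  rw [← orderOf_eq_prime h1 hne]
  exact orderOf_dvd_of_pow_eq_one h5

theorem prime_mem_of_dvd_of_smooth_geom {c : ℕ} (hc : c ∈ codes) {u p : ℕ} (hu : Odd u)
    (hs : Smooth (geom u (ofBits c))) (hp : p.Prime) (hpu : p ∣ u) :
    p ∈ [3, 5, 7, 13, 17, 31, 73, 127] := by
  have hp2 : p ≠ 2 := by
    rintro rfl
    exact (Nat.not_even_iff_odd.mpr hu) (even_iff_two_dvd.mpr hpu)
  have hs' := hs.of_dvd (geom_dvd_geom hpu (ofBits_add_one_ne_zero hc))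
  have hnu : ¬ IsUnit (geom p (ofBits c)) := by
    intro h
    have h1 := natDegree_eq_zero_of_isUnit h
    rw [← geom_X_comp, natDegree_comp, ← ofBits_two_pow_sub_one, natDegree_ofBits] at h1
    have h2 := (irreducible_of_mem_codes hc).natDegree_pos
    have h3 : 2 ≤ p := hp.two_le
    have h4 : 2 ^ 1 ≤ 2 ^ p - 1 := by
      have : 2 ^ 2 ≤ 2 ^ p := Nat.pow_le_pow_right two_pos h3
      omega
    have h5 := (Nat.le_log2 (by omega)).mpr h4
    rcases Nat.mul_eq_zero.mp h1 with h | h <;> omega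
  have hne : geom p (ofBits c) ≠ 0 := by
    intro h
    have h1 := geom_mul_sub_one p (ofBits c)
    rw [h, zero_mul] at h1
    have h2 : ofBits c ^ p = 1 := by
      rw [← sub_eq_zero, CharTwo.sub_eq_add, ← h1]
    exact (irreducible_of_mem_codes hc).not_isUnit
      ((isUnit_pow_iff hp.ne_zero).mp (h2 ▸ isUnit_one))
  obtain ⟨Q, hQ, hQd⟩ := WfDvdMonoid.exists_irreducible_factor hnu hne
  obtain ⟨d, hd, rfl⟩ := hs' Q hQ hQd
  have h1 := prime_dvd_of_irreducible_dvd_geom hQ hp hp2 hQd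
  rw [natDegree_ofBits] at h1
  -- The product is a common multiple of 2^d - 1 over all degrees d of codes; the second factor 3 is
  -- needed for d = 6 and d = 12.
  have h2 : codes.all (fun d => (3 * 3 * 5 * 7 * 13 * 17 * 31 * 73 * 127) % (2 ^ d.log2 - 1) == 0)
      = true := by decide +kernel
  have h3 := List.all_eq_true.mp h2 d hd
  rw [beq_iff_eq] at h3
  have h4 := h1.trans (Nat.dvd_of_mod_eq_zero h3)
  simp only [hp.dvd_mul] at h4
  simp only [List.mem_cons, List.not_mem_nil, or_false]
  have h5 : ∀ q, q.Prime → p ∣ q → p = q := fun q hq h => (Nat.prime_dvd_prime_iff_eq hp hq).mp h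
  rcases h4 with (((((((h | h) | h) | h) | h) | h) | h) | h) | h <;>
    have := h5 _ (by norm_num) h <;> simp [this]

/-- Numbers that do not divide `u` if all irreducible factors of `1 + P + ⋯ + P ^ (u - 1)` are
given by the codes, where `P` has code `c`. -/
def forbidden (c : ℕ) : List ℕ :=
  if c = 2 ∨ c = 3 then [17, 31, 73, 127, 25, 27, 45, 49, 169, 21, 35, 39, 65, 91]
  else if c = 7 then [13, 17, 31, 73, 127, 9, 25, 49, 21, 35]
  else if c = 11 ∨ c = 13 ∨ c = 19 ∨ c = 109 then [5, 7, 13, 17, 31, 73, 127, 9]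
  else [3, 5, 7, 13, 17, 31, 73, 127]

/-- A divisor of `1 + x + ⋯ + x ^ (u - 1)`. -/
def geomDivisor (u : ℕ) : ℕ :=
  if u = 17 then 313 else if u = 31 then 47 else if u = 73 then 535 else if u = 127 then 143
  else 2 ^ u - 1

theorem geomDivisor_dvd (u : ℕ) : ofBits (geomDivisor u) ∣ geom u X := by
  rw [← ofBits_two_pow_sub_one]
  unfold geomDivisor
  split_ifs with h1 h2 h3 h4
  · subst h1; exact dvd_of_modBits_eq_zero (by decide +kernel)
  · subst h2; exact dvd_of_modBits_eq_zero (by decide +kernel)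
  · subst h3; exact dvd_of_modBits_eq_zero (by decide +kernel)
  · subst h4; exact dvd_of_modBits_eq_zero (by decide +kernel)
  · exact dvd_rfl

/-- For u = 31, 73, 127 the full geometric sum can exceed the degree limit of `roughTest`; a small
divisor with a bad factor is enough. -/
theorem roughTest_forbidden : codes.all (fun c => (forbidden c).all fun b =>
    roughTest (compBits (geomDivisor b) c)) = true := by decide +kernel

theorem not_dvd_of_mem_forbidden {c : ℕ} (hc : c ∈ codes) {u b : ℕ}
    (hs : Smooth (geom u (ofBits c))) (hb : b ∈ forbidden c) : ¬ b ∣ u := by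
  intro hbu
  have h1 := List.all_eq_true.mp (List.all_eq_true.mp roughTest_forbidden c hc) b hb
  refine not_smooth_of_roughTest h1 (hs.of_dvd ?_)
  refine dvd_trans ?_ (geom_dvd_geom hbu (ofBits_add_one_ne_zero hc))
  rw [ofBits_compBits, ← geom_X_comp b]
  obtain ⟨r, hr⟩ := geomDivisor_dvd b
  rw [hr, mul_comp]
  exact dvd_mul_right _ _

/-- The odd numbers `u` for which all irreducible factors of `1 + P + ⋯ + P ^ (u - 1)` are given by
the codes, where `P` has code `c`. -/
def options (c : ℕ) : List ℕ :=
  if c = 2 ∨ c = 3 then [1, 3, 5, 7, 9, 13, 15]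
  else if c = 7 then [1, 3, 5, 7, 15]
  else if c = 11 ∨ c = 13 ∨ c = 19 ∨ c = 109 then [1, 3]
  else [1]

/-- Divisors of u are built from 1 one prime at a time: an admissible divisor times an admissible
prime is again admissible or is a multiple of a forbidden number. -/
theorem mem_options {c : ℕ} (hc : c ∈ codes) {u : ℕ} (hu : Odd u)
    (hs : Smooth (geom u (ofBits c))) : u ∈ options c := by
  have h1 : codes.all (fun c => (options c).all fun m => [3, 5, 7, 13, 17, 31, 73, 127].all fun p =>
      decide (p * m ∈ options c) || (forbidden c).any fun b => (p * m) % b == 0) = true := by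
    decide +kernel
  have h2 := List.all_eq_true.mp h1 c hc
  have h3 : codes.all (fun c => decide (1 ∈ options c)) = true := by decide +kernel
  have key : ∀ w, w ∣ u → w ≠ 0 → w ∈ options c := by
    intro w
    induction w using induction_on_primes with
    | zero => exact fun _ h => absurd rfl h
    | one => exact fun _ _ => by simpa using List.all_eq_true.mp h3 c hc
    | prime_mul p a hp ih =>
      intro hd h0
      have ha := ih ((dvd_mul_left a p).trans hd) (right_ne_zero_of_mul h0)
      have hp' := prime_mem_of_dvd_of_smooth_geom hc hu hs hp ((dvd_mul_right p a).trans hd)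
      have h4 := List.all_eq_true.mp (List.all_eq_true.mp h2 a ha) p hp'
      rw [Bool.or_eq_true, decide_eq_true_iff, List.any_eq_true] at h4
      rcases h4 with h4 | ⟨b, hb, h4⟩
      · exact h4
      · rw [beq_iff_eq] at h4
        exact absurd ((Nat.dvd_of_mod_eq_zero h4).trans hd) (not_dvd_of_mem_forbidden hc hs hb)
  exact key u dvd_rfl hu.pos.ne'

/-! ### The divisor sum of a product of prime powers -/

theorem sigma_mul {B C : (ZMod 2)[X]} (hB : B ≠ 0) (hC : C ≠ 0) (h : IsCoprime B C) :
    sigma (B * C) = sigma B * sigma C := by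
  classical
  have himg : {D : (ZMod 2)[X] | D ∣ B * C} =
      (fun p : (ZMod 2)[X] × (ZMod 2)[X] => p.1 * p.2) '' ({D | D ∣ B} ×ˢ {D | D ∣ C}) := by
    ext D
    simp only [Set.mem_ofPred_eq, Set.mem_image, Set.mem_prod, Prod.exists]
    constructor
    · intro hD
      obtain ⟨a, b, ha, hb, rfl⟩ := exists_dvd_and_dvd_of_dvd_mul hD
      exact ⟨a, b, ⟨ha, hb⟩, rfl⟩
    · rintro ⟨a, b, ⟨ha, hb⟩, rfl⟩
      exact mul_dvd_mul ha hb
  have hinj : Set.InjOn (fun p : (ZMod 2)[X] × (ZMod 2)[X] => p.1 * p.2)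
      ({D | D ∣ B} ×ˢ {D | D ∣ C}) := by
    rintro ⟨a, b⟩ ⟨ha, hb⟩ ⟨a', b'⟩ ⟨ha', hb'⟩ heq
    simp only [Set.mem_ofPred_eq] at ha hb ha' hb' heq
    have h1 : a = a' := by
      refine eq_of_associated (associated_of_dvd_dvd ?_ ?_)
      · exact ((h.of_isCoprime_of_dvd_left ha).of_isCoprime_of_dvd_right hb').dvd_of_dvd_mul_right
          (heq ▸ dvd_mul_right a b)
      · exact ((h.of_isCoprime_of_dvd_left ha').of_isCoprime_of_dvd_right hb).dvd_of_dvd_mul_right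
          (heq ▸ dvd_mul_right a' b')
    subst h1
    rw [mul_right_cancel₀ (ne_zero_of_dvd_ne_zero hB ha) ((mul_comm b a).trans
      (heq.trans (mul_comm a b')))]
  rw [sigma, himg, finsum_mem_image hinj, sigma, sigma,
    finsum_mem_eq_finite_toFinset_sum _ ((finite_divisors hB).prod (finite_divisors hC)),
    finsum_mem_eq_finite_toFinset_sum _ (finite_divisors hB),
    finsum_mem_eq_finite_toFinset_sum _ (finite_divisors hC), Finset.sum_mul_sum,
    ← Finset.sum_product']
  refine Finset.sum_congr ?_ fun _ _ => rfl
  ext ⟨a, b⟩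
  simp

theorem sigma_prime_pow {P : (ZMod 2)[X]} (hP : Irreducible P) (h : ℕ) :
    sigma (P ^ h) = geom (h + 1) P := by
  classical
  have hset : {D : (ZMod 2)[X] | D ∣ P ^ h} = ↑((Finset.range (h + 1)).image fun i => P ^ i) := by
    ext D
    simp only [Set.mem_ofPred_eq, Finset.coe_image, Set.mem_image, Finset.mem_coe, Finset.mem_range]
    constructor
    · intro hD
      obtain ⟨i, hi, ha⟩ := (dvd_prime_pow hP.prime h).mp hD
      exact ⟨i, by omega, (eq_of_associated ha).symm⟩
    · rintro ⟨i, hi, rfl⟩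
      exact pow_dvd_pow _ (by omega)
  rw [sigma, hset, finsum_mem_coe_finset, Finset.sum_image, geom]
  exact fun i _ j _ hij => pow_injective_of_not_isUnit hP.not_isUnit hP.ne_zero hij

theorem isCoprime_ofBits {c d : ℕ} (hc : c ∈ codes) (hd : d ∈ codes) (h : c ≠ d) :
    IsCoprime (ofBits c) (ofBits d) := by
  refine ((irreducible_of_mem_codes hc).coprime_iff_not_dvd).mpr fun hdvd => h ?_
  exact ofBits_injective (eq_of_associated
    ((irreducible_of_mem_codes hc).associated_of_dvd (irreducible_of_mem_codes hd) hdvd))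

theorem sigma_prod (s : Finset ℕ) (hs : ∀ c ∈ s, c ∈ codes) (e : ℕ → ℕ) :
    sigma (∏ c ∈ s, ofBits c ^ e c) = ∏ c ∈ s, geom (e c + 1) (ofBits c) := by
  induction s using Finset.induction_on with
  | empty =>
    have h := sigma_prime_pow (irreducible_of_mem_codes (c := 2) (by decide)) 0
    simpa [geom] using h
  | insert a s ha ih =>
    have h0 : ∀ c ∈ insert a s, ofBits c ^ e c ≠ 0 := fun c hc =>
      pow_ne_zero _ (irreducible_of_mem_codes (hs c hc)).ne_zero
    rw [Finset.prod_insert ha, Finset.prod_insert ha, sigma_mul (h0 a (by simp))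
      (Finset.prod_ne_zero_iff.mpr fun i hi => h0 i (by simp [hi])), ih fun c hc => hs c (by simp [hc]),
      sigma_prime_pow (irreducible_of_mem_codes (hs a (by simp)))]
    refine IsCoprime.prod_right fun i hi => (isCoprime_ofBits (hs a (by simp))
      (hs i (by simp [hi])) ?_).pow
    rintro rfl
    exact ha hi

/-- Multiplied by P + 1, this is the Frobenius identity P^(2^n u) + 1 = (P^u + 1)^(2^n). -/
theorem geom_two_pow_mul {P : (ZMod 2)[X]} (hP : P + 1 ≠ 0) (n u : ℕ) :
    geom (2 ^ n * u) P = (P + 1) ^ (2 ^ n - 1) * geom u P ^ 2 ^ n := by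
  refine mul_right_cancel₀ hP ?_
  rw [geom_mul_sub_one, mul_comm (2 ^ n) u, pow_mul]
  have h := congrArg (fun R => R ^ 2 ^ n) (geom_mul_sub_one u P)
  simp only [mul_pow, add_pow_char_pow, one_pow] at h
  rw [← h, ← one_pow (2 ^ n), ← add_pow_char_pow, one_pow]
  obtain ⟨m, hm⟩ : ∃ m, 2 ^ n = m + 1 := Nat.exists_eq_succ_of_ne_zero (by positivity)
  rw [hm, Nat.add_sub_cancel]
  ring

/-! ### Explicit factorizations and the equations for the exponents -/

/-- The exponents of `x`, `x + 1` and `M1` in `1 + P`, where `P` has code `c`. -/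
def succExps (c : ℕ) : ℕ × ℕ × ℕ :=
  if c = 2 then (0, 1, 0) else if c = 3 then (1, 0, 0) else if c = 7 then (1, 1, 0)
  else if c = 11 then (1, 2, 0) else if c = 13 then (2, 1, 0) else if c = 31 then (1, 3, 0)
  else if c = 25 then (3, 1, 0) else if c = 41 then (3, 2, 0) else if c = 137 then (3, 4, 0)
  else if c = 193 then (6, 1, 0) else if c = 61 then (2, 3, 0) else if c = 241 then (4, 3, 0)
  else if c = 171 then (1, 6, 0) else if c = 515 then (1, 8, 0) else if c = 769 then (8, 1, 0)
  else if c = 19 then (1, 1, 1) else if c = 109 then (2, 2, 1) else if c = 8191 then (1, 3, 4)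
  else if c = 73 then (3, 1, 1) else if c = 91 then (1, 3, 1) else if c = 6553 then (3, 1, 4)
  else if c = 379 then (1, 1, 3) else if c = 361 then (3, 3, 1) else if c = 4915 then (1, 1, 5)
  else if c = 145 then (4, 1, 1) else if c = 55 then (1, 2, 1) else if c = 253 then (2, 1, 2)
  else if c = 239 then (1, 4, 1) else if c = 37 then (2, 1, 1) else (1, 2, 2)

/-- The irreducible factors of `1 + P`, where `P` has code `c`. -/
def succFactors (c : ℕ) : List ℕ :=
  List.replicate (succExps c).1 2 ++ List.replicate (succExps c).2.1 3 ++
    List.replicate (succExps c).2.2 7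

/-- The irreducible factors of `1 + P + ⋯ + P ^ (u - 1)`, where `P` has code `c`. -/
def geomFactors (c u : ℕ) : List ℕ :=
  if u = 3 then
    if c = 2 ∨ c = 3 then [7] else if c = 7 then [19] else if c = 11 then [7, 25]
    else if c = 13 then [7, 31] else if c = 19 then [31, 25] else if c = 109 then [19, 379] else []
  else if u = 5 then if c = 2 then [31] else if c = 3 then [25] else if c = 7 then [361] else []
  else if u = 7 then if c = 2 ∨ c = 3 then [11, 13] else if c = 7 then [11, 13, 109] else []
  else if u = 9 then if c = 2 then [7, 73] else if c = 3 then [7, 91] else []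
  else if u = 13 then if c = 2 then [8191] else if c = 3 then [6553] else []
  else if u = 15 then
    if c = 2 ∨ c = 3 then [7, 31, 25, 19] else if c = 7 then [31, 25, 19, 379, 361] else []
  else []

theorem succFactors_prod {c : ℕ} (hc : c ∈ codes) :
    ((succFactors c).map ofBits).prod = ofBits c + 1 := by
  have h : codes.all (fun c => (succFactors c).foldr mulBits 1 == c ^^^ 1) = true := by
    decide +kernel
  have h1 := List.all_eq_true.mp h c hc
  rw [beq_iff_eq] at h1
  rw [← ofBits_foldr, h1, ofBits_xor, ofBits_one]

/-- The default value `[]` is correct for u = 1, where the sum is 1; pairs outside `options` are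
never used. -/
theorem geomFactors_prod {c u : ℕ} (hc : c ∈ codes) (hu : u ∈ options c) :
    ((geomFactors c u).map ofBits).prod = geom u (ofBits c) := by
  have h : codes.all (fun c => (options c).all fun u =>
      (geomFactors c u).foldr mulBits 1 == compBits (2 ^ u - 1) c) = true := by
    decide +kernel
  have h1 := List.all_eq_true.mp (List.all_eq_true.mp h c hc) u hu
  rw [beq_iff_eq] at h1
  rw [← ofBits_foldr, h1, ofBits_compBits, ofBits_two_pow_sub_one, geom_X_comp]

theorem mem_codes_of_mem_succFactors {c d : ℕ} (hd : d ∈ succFactors c) : d ∈ codes := by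
  simp only [succFactors, List.mem_append, List.mem_replicate] at hd
  rcases hd with (⟨_, rfl⟩ | ⟨_, rfl⟩) | ⟨_, rfl⟩ <;> decide

theorem mem_codes_of_mem_geomFactors {c u : ℕ} (hc : c ∈ codes) (hu : u ∈ options c) {d : ℕ}
    (hd : d ∈ geomFactors c u) : d ∈ codes := by
  have h : codes.all (fun c => (options c).all fun u =>
      (geomFactors c u).all fun d => decide (d ∈ codes)) = true := by
    decide +kernel
  simpa using List.all_eq_true.mp (List.all_eq_true.mp (List.all_eq_true.mp h c hc) u hu) d hd

/-- The exponents of a perfect polynomial whose irreducible divisors are given by the codes satisfy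
a system of equations. -/
theorem exponent_system {A : (ZMod 2)[X]} (hA : IsPerfect A) (hs : Smooth A) :
    ∃ n u : ℕ → ℕ, ∀ c ∈ codes, u c ∈ options c ∧ val c A + 1 = 2 ^ n c * u c ∧
      val c A = (codes.map fun d => (2 ^ n d - 1) * (succFactors d).count c +
        2 ^ n d * (geomFactors d (u d)).count c).sum := by
  choose n u hu hnu using fun c => Nat.exists_eq_two_pow_mul_odd (n := val c A + 1) (by omega)
  have hprod := hs.eq_prod hA.1
  have hσ : A = ∏ c ∈ codes.toFinset, geom (val c A + 1) (ofBits c) :=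
    calc A = sigma A := hA.2.symm
      _ = sigma (∏ c ∈ codes.toFinset, ofBits c ^ val c A) := congrArg sigma hprod
      _ = _ := sigma_prod _ (fun c hc => List.mem_toFinset.mp hc) _
  -- Perfection enters here: each geometric sum divides σ(A) = A and so inherits smoothness, which
  -- restricts `u c`.
  have hdvd : ∀ c ∈ codes, geom (u c) (ofBits c) ∣ A := by
    intro c hc
    have h1 : geom (u c) (ofBits c) ∣ geom (val c A + 1) (ofBits c) :=
      geom_dvd_geom ((hnu c).symm ▸ dvd_mul_left _ _) (ofBits_add_one_ne_zero hc)
    rw [hσ]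
    exact h1.trans (Finset.dvd_prod_of_mem (fun c => geom (val c A + 1) (ofBits c))
      (List.mem_toFinset.mpr hc))
  have hmem : ∀ c ∈ codes, u c ∈ options c :=
    fun c hc => mem_options hc (hu c) (hs.of_dvd (hdvd c hc))
  have hgeom : ∀ c ∈ codes, geom (u c) (ofBits c) ≠ 0 :=
    fun c hc => ne_zero_of_dvd_ne_zero hA.1 (hdvd c hc)
  refine ⟨n, u, fun c hc => ⟨hmem c hc, hnu c, ?_⟩⟩
  have h1 := congrArg (val c) hσ
  rw [val_prod] at h1
  · rw [h1, List.sum_toFinset _ codes_nodup]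
    congr 1
    refine List.map_congr_left fun d hd => ?_
    rw [hnu, geom_two_pow_mul (ofBits_add_one_ne_zero hd), val_mul _
      (pow_ne_zero _ (ofBits_add_one_ne_zero hd)) (pow_ne_zero _ (hgeom d hd)), val_pow, val_pow,
      ← succFactors_prod hd, ← geomFactors_prod hd (hmem d hd),
      val_list_prod _ _ fun _ => mem_codes_of_mem_succFactors,
      val_list_prod _ _ fun _ => mem_codes_of_mem_geomFactors hd (hmem d hd)]
  · intro d hd
    rw [List.mem_toFinset] at hd
    rw [hnu, geom_two_pow_mul (ofBits_add_one_ne_zero hd)]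
    exact mul_ne_zero (pow_ne_zero _ (ofBits_add_one_ne_zero hd)) (pow_ne_zero _ (hgeom d hd))

/-! ### Binary ones as a bound for the power of two dividing e + 1 -/

/-- Carries never increase the number of binary ones. When both summands are odd, the carry adds at
most one to the count for the halves, while two final ones are lost. -/
theorem length_bitIndices_add_le (a b : ℕ) :
    (a + b).bitIndices.length ≤ a.bitIndices.length + b.bitIndices.length := by
  induction hn : a + b using Nat.strong_induction_on generalizing a b with
  | _ n ih =>
    subst hn
    rcases Nat.even_or_odd' a with ⟨i, rfl | rfl⟩ <;> rcases Nat.even_or_odd' b with ⟨j, rfl | rfl⟩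
    · rcases Nat.eq_zero_or_pos (i + j) with h | h
      · obtain ⟨rfl, rfl⟩ : i = 0 ∧ j = 0 := by omega
        simp
      · have h1 := ih (i + j) (by omega) i j rfl
        rw [← mul_add, Nat.bitIndices_two_mul, Nat.bitIndices_two_mul, Nat.bitIndices_two_mul]
        simpa using h1
    · have h1 := ih (i + j) (by omega) i j rfl
      rw [← add_assoc, ← mul_add, Nat.bitIndices_two_mul, Nat.bitIndices_two_mul_add_one,
        Nat.bitIndices_two_mul_add_one]
      simp only [List.length_cons, List.length_map]
      omega
    · have h1 := ih (i + j) (by omega) i j rfl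
      rw [add_right_comm, ← mul_add, Nat.bitIndices_two_mul, Nat.bitIndices_two_mul_add_one,
        Nat.bitIndices_two_mul_add_one]
      simp only [List.length_cons, List.length_map]
      omega
    · have h1 := ih (i + j) (by omega) i j rfl
      have h2 := ih (i + j + 1) (by omega) (i + j) 1 rfl
      rw [show 2 * i + 1 + (2 * j + 1) = 2 * (i + j + 1) by ring, Nat.bitIndices_two_mul,
        Nat.bitIndices_two_mul_add_one, Nat.bitIndices_two_mul_add_one]
      simp only [List.length_cons, List.length_map, Nat.bitIndices_one, List.length_nil] at h2 ⊢
      omega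

theorem le_length_bitIndices {n u e : ℕ} (h : e + 1 = 2 ^ n * u) : n ≤ e.bitIndices.length := by
  induction n generalizing e with
  | zero => exact Nat.zero_le _
  | succ n ih =>
    rw [pow_succ', mul_assoc] at h
    obtain ⟨f, hf⟩ : ∃ f, 2 ^ n * u = f + 1 := Nat.exists_eq_succ_of_ne_zero (by omega)
    obtain rfl : e = 2 * f + 1 := by omega
    have := ih hf.symm
    rw [Nat.bitIndices_two_mul_add_one]
    simpa using this

/-- `p` if `u` belongs to the list `l`, and `0` otherwise. -/
def gate (l : List ℕ) (u p : ℕ) : ℕ := if u ∈ l then p else 0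

theorem length_bitIndices_gate_le (l : List ℕ) (u k : ℕ) :
    (gate l u (2 ^ k)).bitIndices.length ≤ 1 := by
  unfold gate
  split_ifs <;> simp

/-- Each term contributes at most one binary one, however large it is. Hence n is bounded without
any prior bound on the terms. -/
theorem le_length_of_sum_gate {n u : ℕ} (L : List (List ℕ × ℕ × ℕ))
    (h : (L.map fun q => gate q.1 q.2.1 (2 ^ q.2.2)).sum + 1 = 2 ^ n * u) : n ≤ L.length := by
  refine (le_length_bitIndices h).trans ?_
  clear h
  induction L with
  | nil => simp
  | cons q L ih =>
    rw [List.map_cons, List.sum_cons]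
    refine (length_bitIndices_add_le _ _).trans ?_
    have := length_bitIndices_gate_le q.1 q.2.1 q.2.2
    rw [List.length_cons]
    omega

/-- The largest divisor of `m` of the form `2 ^ n` with `n ≤ 10`. -/
def twoPart (m : ℕ) : ℕ := Nat.gcd m 1024

theorem twoPart_eq {n u m : ℕ} (h : m = 2 ^ n * u) (hn : n ≤ 10) (hu : Odd u) :
    twoPart m = 2 ^ n := by
  have h1 : (1024 : ℕ) = 2 ^ n * 2 ^ (10 - n) := by
    rw [← pow_add, Nat.add_sub_cancel' hn]; norm_num
  rw [twoPart, h, h1, Nat.gcd_mul_left,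
    Nat.Coprime.gcd_eq_one (Nat.Coprime.pow_right _ (Nat.coprime_two_right.mpr hu)), mul_one]

/-- The values of `u` for which `c` occurs among the factors of `1 + P + ⋯ + P ^ (u - 1)`, where `P`
has code `d`. -/
def gateList (d c : ℕ) : List ℕ := (options d).filter fun u => decide (c ∈ geomFactors d u)

theorem mul_count_geomFactors {c d u : ℕ} (hd : d ∈ codes) (hu : u ∈ options d) (p : ℕ) :
    p * (geomFactors d u).count c = gate (gateList d c) u p := by
  have h : codes.all (fun d => (options d).all fun u => decide (geomFactors d u).Nodup) = true := by
    decide +kernel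
  have h1 := of_decide_eq_true (List.all_eq_true.mp (List.all_eq_true.mp h d hd) u hu)
  rw [List.Nodup.count h1, gate, gateList]
  simp [hu]

/-! ### The explicit system and its immediate bounds -/

/-- The system of equations satisfied by the exponents, with `2 ^ n - 1` where an exponent has this
form for trivial reasons. -/
structure System (e n u : ℕ → ℕ) : Prop where
  absent : ∀ c ∈ [41, 137, 193, 61, 241, 171, 515, 769, 4915, 145, 55, 253, 239, 37, 131], e c = 0
  mersenne : ∀ c ∈ [31, 25, 8191, 73, 91, 6553, 379, 361], e c + 1 = 2 ^ n c
  general : ∀ c ∈ [2, 3, 7, 11, 13, 19, 109], u c ∈ options c ∧ e c + 1 = 2 ^ n c * u c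
  eq2 : e 2 = 2 ^ n 3 - 1 + (2 ^ n 7 - 1) + (2 ^ n 11 - 1) + (2 ^ n 13 - 1) * 2 + e 31 + e 25 * 3 +
    (2 ^ n 19 - 1) + (2 ^ n 109 - 1) * 2 + e 8191 + e 73 * 3 + e 91 + e 6553 * 3 + e 379 + e 361 * 3
  eq3 : e 3 = 2 ^ n 2 - 1 + (2 ^ n 7 - 1) + (2 ^ n 11 - 1) * 2 + (2 ^ n 13 - 1) + e 31 * 3 + e 25 +
    (2 ^ n 19 - 1) + (2 ^ n 109 - 1) * 2 + e 8191 * 3 + e 73 + e 91 * 3 + e 6553 + e 379 + e 361 * 3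
  eq7 : e 7 = gate [3, 9, 15] (u 2) (2 ^ n 2) + gate [3, 9, 15] (u 3) (2 ^ n 3) +
    gate [3] (u 11) (2 ^ n 11) + gate [3] (u 13) (2 ^ n 13) + (2 ^ n 19 - 1) + (2 ^ n 109 - 1) +
    e 8191 * 4 + e 73 + e 91 + e 6553 * 4 + e 379 * 3 + e 361
  eq11 : e 11 = gate [7] (u 2) (2 ^ n 2) + gate [7] (u 3) (2 ^ n 3) + gate [7] (u 7) (2 ^ n 7)
  eq13 : e 13 = gate [7] (u 2) (2 ^ n 2) + gate [7] (u 3) (2 ^ n 3) + gate [7] (u 7) (2 ^ n 7)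
  eq31 : e 31 = gate [5, 15] (u 2) (2 ^ n 2) + gate [15] (u 3) (2 ^ n 3) +
    gate [15] (u 7) (2 ^ n 7) + gate [3] (u 13) (2 ^ n 13) + gate [3] (u 19) (2 ^ n 19)
  eq25 : e 25 = gate [15] (u 2) (2 ^ n 2) + gate [5, 15] (u 3) (2 ^ n 3) +
    gate [15] (u 7) (2 ^ n 7) + gate [3] (u 11) (2 ^ n 11) + gate [3] (u 19) (2 ^ n 19)
  eq19 : e 19 = gate [15] (u 2) (2 ^ n 2) + gate [15] (u 3) (2 ^ n 3) +
    gate [3, 15] (u 7) (2 ^ n 7) + gate [3] (u 109) (2 ^ n 109)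
  eq109 : e 109 = gate [7] (u 7) (2 ^ n 7)
  eq8191 : e 8191 = gate [13] (u 2) (2 ^ n 2)
  eq73 : e 73 = gate [9] (u 2) (2 ^ n 2)
  eq91 : e 91 = gate [9] (u 3) (2 ^ n 3)
  eq6553 : e 6553 = gate [13] (u 3) (2 ^ n 3)
  eq379 : e 379 = gate [15] (u 7) (2 ^ n 7) + gate [3] (u 109) (2 ^ n 109)
  eq361 : e 361 = gate [5, 15] (u 7) (2 ^ n 7)

set_option maxHeartbeats 2000000 in
theorem system_of_exponents {e n u : ℕ → ℕ} (h : ∀ c ∈ codes, u c ∈ options c ∧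
    e c + 1 = 2 ^ n c * u c ∧ e c = (codes.map fun d => (2 ^ n d - 1) * (succFactors d).count c +
      2 ^ n d * (geomFactors d (u d)).count c).sum) : System e n u := by
  have h1 : ∀ c ∈ codes, e c = (codes.map fun d => (2 ^ n d - 1) * (succFactors d).count c +
      gate (gateList d c) (u d) (2 ^ n d)).sum := by
    intro c hc
    rw [(h c hc).2.2]
    congr 1
    exact List.map_congr_left fun d hd => by rw [mul_count_geomFactors hd (h d hd).1]
  have h2 : ∀ c ∈ codes, options c = [1] → e c + 1 = 2 ^ n c := by
    intro c hc h2
    obtain ⟨h3, h4, -⟩ := h c hc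
    rw [h2, List.mem_singleton] at h3
    rw [h4, h3, mul_one]
  -- These fifteen polynomials occur in no P + 1 and in no admissible geometric sum, so their
  -- exponents vanish.
  have habs : ∀ c ∈ [41, 137, 193, 61, 241, 171, 515, 769, 4915, 145, 55, 253, 239, 37, 131],
      e c = 0 ∧ 2 ^ n c - 1 = 0 := by
    intro c hc
    have h4 : ∀ c ∈ [41, 137, 193, 61, 241, 171, 515, 769, 4915, 145, 55, 253, 239, 37, 131],
      c ∈ codes ∧ options c = [1] ∧
        ∀ d ∈ codes, (succFactors d).count c = 0 ∧ gateList d c = [] := by decide +kernel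
    obtain ⟨h5, h6, h7⟩ := h4 c hc
    have h8 : e c = 0 := by
      rw [h1 c h5, List.sum_eq_zero_iff]
      intro k hk
      obtain ⟨d, hd, rfl⟩ := List.mem_map.mp hk
      simp [h7 d hd, gate]
    have h9 := h2 c h5 h6
    exact ⟨h8, by omega⟩
  have hmer : ∀ c ∈ [31, 25, 8191, 73, 91, 6553, 379, 361],
      e c + 1 = 2 ^ n c ∧ 2 ^ n c - 1 = e c := by
    intro c hc
    have h4 : ∀ c ∈ [31, 25, 8191, 73, 91, 6553, 379, 361], c ∈ codes ∧ options c = [1] := by decide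
    have h5 := h2 c (h4 c hc).1 (h4 c hc).2
    exact ⟨h5, by omega⟩
  have hnil : ∀ v p, gate [] v p = 0 := fun _ _ => rfl
  have habs' := habs
  have hmer' := hmer
  simp only [List.forall_mem_cons] at habs hmer
  refine ⟨fun c hc => (habs' c hc).1, fun c hc => (hmer' c hc).1, fun c hc => ?_, ?_, ?_, ?_, ?_,
    ?_, ?_, ?_, ?_, ?_, ?_, ?_, ?_, ?_, ?_, ?_⟩
  · have h4 : ∀ c ∈ [2, 3, 7, 11, 13, 19, 109], c ∈ codes := by decide
    exact ⟨(h c (h4 c hc)).1, (h c (h4 c hc)).2.1⟩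
  all_goals
    rw [h1 _ (by decide)]
    simp [codes, habs, hmer, succFactors, List.count_replicate, succExps, gateList, options,
      geomFactors, hnil, add_assoc]

/-- The exponents of a polynomial with prime factors among `x`, `x + 1`, `M1`, `M2`, `M3`, `M4`,
`M5`, `S1`, listed in the order of the codes, where `M2` and `M3` have the same exponent. -/
def exponentRow (x y m1 m2 m4 m5 s1 : ℕ) : List ℕ :=
  [x, y, m1, m2, m2, m4, m5, 0, 0, 0, 0, 0, 0, 0, 0, s1, 0, 0, 0, 0, 0, 0, 0, 0, 0, 0, 0, 0, 0, 0]

namespace System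

variable {e n u : ℕ → ℕ}

/-- This bound and the similar ones below count the power-of-two terms in the respective equation.
-/
theorem n109_le (h : System e n u) : n 109 ≤ 1 :=
  le_length_of_sum_gate [([7], u 7, n 7)] (by
    rw [← (h.general 109 (by simp)).2, h.eq109]; simp)

theorem n19_le (h : System e n u) : n 19 ≤ 4 :=
  le_length_of_sum_gate [([15], u 2, n 2), ([15], u 3, n 3), ([3, 15], u 7, n 7), ([3], u 109, n 109)]
    (by rw [← (h.general 19 (by simp)).2, h.eq19]; simp [add_assoc])

theorem n11_le (h : System e n u) : n 11 ≤ 3 :=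
  le_length_of_sum_gate [([7], u 2, n 2), ([7], u 3, n 3), ([7], u 7, n 7)]
    (by rw [← (h.general 11 (by simp)).2, h.eq11]; simp [add_assoc])

theorem n13_le (h : System e n u) : n 13 ≤ 3 :=
  le_length_of_sum_gate [([7], u 2, n 2), ([7], u 3, n 3), ([7], u 7, n 7)]
    (by rw [← (h.general 13 (by simp)).2, h.eq13]; simp [add_assoc])

theorem n31_le (h : System e n u) : n 31 ≤ 5 :=
  le_length_of_sum_gate (u := 1) [([5, 15], u 2, n 2), ([15], u 3, n 3), ([15], u 7, n 7),
    ([3], u 13, n 13), ([3], u 19, n 19)]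
    (by rw [mul_one, ← h.mersenne 31 (by simp), h.eq31]; simp [add_assoc])

theorem n25_le (h : System e n u) : n 25 ≤ 5 :=
  le_length_of_sum_gate (u := 1) [([15], u 2, n 2), ([5, 15], u 3, n 3), ([15], u 7, n 7),
    ([3], u 11, n 11), ([3], u 19, n 19)]
    (by rw [mul_one, ← h.mersenne 25 (by simp), h.eq25]; simp [add_assoc])

theorem n8191_le (h : System e n u) : n 8191 ≤ 1 :=
  le_length_of_sum_gate (u := 1) [([13], u 2, n 2)]
    (by rw [mul_one, ← h.mersenne 8191 (by simp), h.eq8191]; simp)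

theorem n73_le (h : System e n u) : n 73 ≤ 1 :=
  le_length_of_sum_gate (u := 1) [([9], u 2, n 2)]
    (by rw [mul_one, ← h.mersenne 73 (by simp), h.eq73]; simp)

theorem n91_le (h : System e n u) : n 91 ≤ 1 :=
  le_length_of_sum_gate (u := 1) [([9], u 3, n 3)]
    (by rw [mul_one, ← h.mersenne 91 (by simp), h.eq91]; simp)

theorem n6553_le (h : System e n u) : n 6553 ≤ 1 :=
  le_length_of_sum_gate (u := 1) [([13], u 3, n 3)]
    (by rw [mul_one, ← h.mersenne 6553 (by simp), h.eq6553]; simp)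

theorem n379_le (h : System e n u) : n 379 ≤ 2 :=
  le_length_of_sum_gate (u := 1) [([15], u 7, n 7), ([3], u 109, n 109)]
    (by rw [mul_one, ← h.mersenne 379 (by simp), h.eq379]; simp)

theorem n361_le (h : System e n u) : n 361 ≤ 1 :=
  le_length_of_sum_gate (u := 1) [([5, 15], u 7, n 7)]
    (by rw [mul_one, ← h.mersenne 361 (by simp), h.eq361]; simp)

theorem le_mersenne (h : System e n u) {c k : ℕ}
    (hc : c ∈ [31, 25, 8191, 73, 91, 6553, 379, 361]) (hk : n c ≤ k) : e c < 2 ^ k := by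
  have := h.mersenne c hc
  have := Nat.pow_le_pow_right two_pos hk
  omega

theorem general_le (h : System e n u) {c k : ℕ} (hc : c ∈ [11, 13, 19, 109]) (hk : n c ≤ k) :
    e c < 3 * 2 ^ k := by
  have h0 : ∀ c ∈ [11, 13, 19, 109], c ∈ [2, 3, 7, 11, 13, 19, 109] ∧ options c = [1, 3] := by
    decide
  obtain ⟨h1, h2⟩ := h.general c (h0 c hc).1
  rw [(h0 c hc).2] at h1
  have h3 := Nat.pow_le_pow_right two_pos hk
  have h4 : u c ≤ 3 := by
    simp only [List.mem_cons, List.not_mem_nil, or_false] at h1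
    omega
  nlinarith [Nat.mul_le_mul h3 h4]

theorem options2 (h : System e n u) : u 2 ∈ [1, 3, 5, 7, 9, 13, 15] := (h.general 2 (by simp)).1
theorem options3 (h : System e n u) : u 3 ∈ [1, 3, 5, 7, 9, 13, 15] := (h.general 3 (by simp)).1
theorem options7 (h : System e n u) : u 7 ∈ [1, 3, 5, 7, 15] := (h.general 7 (by simp)).1
theorem options19 (h : System e n u) : u 19 ∈ [1, 3] := (h.general 19 (by simp)).1
theorem options109 (h : System e n u) : u 109 ∈ [1, 3] := (h.general 109 (by simp)).1

/-! ### Bounds for x, x + 1 and M1 -/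

/-- A bound for `2 ^ n` in terms of `u` for the two linear polynomials. -/
def linearBound (u : ℕ) : ℕ :=
  if u = 5 ∨ u = 7 ∨ u = 15 then 32 else if u = 9 ∨ u = 13 then 2 else 512

/-- For these u, the number 2^n is a term of an exponent already bounded: that of M4 for u = 5, 15
(below 2^5), of M2 for u = 7 (below 3 · 2^3), of S4 for u = 9 and of S3 for u = 13 (below 2). -/
theorem lt_linearBound2 (h : System e n u) (hu : u 2 ≠ 1) (hu' : u 2 ≠ 3) :
    2 ^ n 2 < linearBound (u 2) := by
  have h0 := h.options2
  have h1 := h.le_mersenne (by simp) h.n31_le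
  have h2 := h.general_le (by simp) h.n11_le
  have h3 := h.le_mersenne (by simp) h.n73_le
  have h4 := h.le_mersenne (by simp) h.n8191_le
  rw [h.eq31] at h1
  rw [h.eq11] at h2
  rw [h.eq73] at h3
  rw [h.eq8191] at h4
  simp only [List.mem_cons, List.not_mem_nil, or_false] at h0
  rcases h0 with h0 | h0 | h0 | h0 | h0 | h0 | h0 <;> simp [h0, gate, linearBound] at * <;> omega

theorem lt_linearBound3 (h : System e n u) (hu : u 3 ≠ 1) (hu' : u 3 ≠ 3) :
    2 ^ n 3 < linearBound (u 3) := by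
  have h0 := h.options3
  have h1 := h.le_mersenne (by simp) h.n25_le
  have h2 := h.general_le (by simp) h.n11_le
  have h3 := h.le_mersenne (by simp) h.n91_le
  have h4 := h.le_mersenne (by simp) h.n6553_le
  rw [h.eq25] at h1
  rw [h.eq11] at h2
  rw [h.eq91] at h3
  rw [h.eq6553] at h4
  simp only [List.mem_cons, List.not_mem_nil, or_false] at h0
  rcases h0 with h0 | h0 | h0 | h0 | h0 | h0 | h0 <;> simp [h0, gate, linearBound] at * <;> omega

/-- A bound for `2 ^ n` in terms of `u` for `M1`. -/
def quadraticBound (u : ℕ) : ℕ :=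
  if u = 3 then 48 else if u = 7 then 6 else if u = 5 ∨ u = 15 then 2 else 512

/-- The bounding exponents are those of S1 for u = 3 (below 3 · 2^4), of S2 for u = 7 (below 3 · 2),
and of S8 for u = 5, 15 (below 2). -/
theorem lt_quadraticBound (h : System e n u) (hu : u 7 ≠ 1) :
    2 ^ n 7 < quadraticBound (u 7) := by
  have h0 := h.options7
  have h1 := h.general_le (by simp) h.n19_le
  have h2 := h.general_le (by simp) h.n109_le
  have h3 := h.le_mersenne (by simp) h.n361_le
  rw [h.eq19] at h1
  rw [h.eq109] at h2
  rw [h.eq361] at h3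
  simp only [List.mem_cons, List.not_mem_nil, or_false] at h0
  rcases h0 with h0 | h0 | h0 | h0 | h0 <;> simp [h0, gate, quadraticBound] at * <;> omega

theorem le_mul2 (h : System e n u) : 2 ^ n 3 + (2 ^ n 7 - 1) ≤ 2 ^ n 2 * u 2 := by
  have h1 := (h.general 2 (by simp)).2
  have h2 := h.eq2
  have := Nat.one_le_two_pow (n := n 3)
  omega

theorem le_mul3 (h : System e n u) : 2 ^ n 2 + (2 ^ n 7 - 1) ≤ 2 ^ n 3 * u 3 := by
  have h1 := (h.general 3 (by simp)).2
  have h2 := h.eq3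
  have := Nat.one_le_two_pow (n := n 2)
  omega

theorem le_mul7 (h : System e n u) :
    gate [3, 9, 15] (u 2) (2 ^ n 2) + gate [3, 9, 15] (u 3) (2 ^ n 3) + 1 ≤ 2 ^ n 7 * u 7 := by
  have h1 := (h.general 7 (by simp)).2
  have h2 := h.eq7
  omega

theorem eq_one_or_even (k : ℕ) : 2 ^ k = 1 ∨ 2 ^ k % 2 = 0 := by
  rcases k with _ | k
  · exact Or.inl rfl
  · exact Or.inr (by rw [pow_succ]; exact Nat.mul_mod_left _ _)

theorem map_codes_of_small (h : System e n u) (h2 : u 2 = 1 ∨ u 2 = 3) (h3 : u 3 = 1 ∨ u 3 = 3)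
    (h7 : e 7 = 0) (h11 : e 11 = 0) (h13 : e 13 = 0) (h31 : e 31 = 0) (h25 : e 25 = 0)
    (h19 : e 19 = 0) (h109 : e 109 = 0) (h379 : e 379 = 0) (h361 : e 361 = 0) :
    codes.map e = exponentRow (e 2) (e 3) 0 0 0 0 0 := by
  have h4 : e 8191 = 0 := by rw [h.eq8191]; rcases h2 with h2 | h2 <;> simp [h2, gate]
  have h5 : e 73 = 0 := by rw [h.eq73]; rcases h2 with h2 | h2 <;> simp [h2, gate]
  have h6 : e 91 = 0 := by rw [h.eq91]; rcases h3 with h2 | h2 <;> simp [h2, gate]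
  have h8 : e 6553 = 0 := by rw [h.eq6553]; rcases h3 with h2 | h2 <;> simp [h2, gate]
  have h9 := h.absent
  simp only [List.forall_mem_cons] at h9
  simp [codes, exponentRow, *]

theorem eq_one_of_zero (h : System e n u) {c : ℕ} (hc : c ∈ [11, 13, 19, 109]) (h0 : e c = 0) :
    u c = 1 ∧ 2 ^ n c = 1 := by
  have h1 : ∀ c ∈ [11, 13, 19, 109], c ∈ [2, 3, 7, 11, 13, 19, 109] := by decide
  have h2 := (h.general c (h1 c hc)).2
  rw [h0, zero_add, eq_comm, mul_eq_one] at h2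
  exact h2.symm

/-- Parity decides. If s = 3 and t = 1, then y = 2x, and m = x + 1 forces x = 1; the second case is
symmetric. If s = t = 3, then x = y and m = 2x + 1 is odd, which is impossible. -/
theorem lt_of_pow_eqs {x y m s t : ℕ} (hx : x = 1 ∨ x % 2 = 0) (hy : y = 1 ∨ y % 2 = 0)
    (hm : m = 1 ∨ m % 2 = 0) (h1 : x * s + 1 = y + m) (h2 : y * t + 1 = x + m)
    (hy0 : 1 ≤ y) (h : s = 3 ∧ t = 1 ∧ m = x + 1 ∨ s = 1 ∧ t = 3 ∧ m = y + 1 ∨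
      s = 3 ∧ t = 3 ∧ m = x + y + 1) : x < 512 ∧ y < 512 ∧ m < 512 := by
  rcases h with ⟨rfl, rfl, h⟩ | ⟨rfl, rfl, h⟩ | ⟨rfl, rfl, h⟩ <;> omega

/-- All exponents except those of x, x + 1 and M1 vanish here. The case u = 1 for both linear
polynomials produces the infinite splitting family; otherwise three equations in powers of two
remain. -/
theorem trivial_or_bounded_of_one (h : System e n u) (h2 : u 2 = 1 ∨ u 2 = 3)
    (h3 : u 3 = 1 ∨ u 3 = 3) (h7 : u 7 = 1) :
    (∃ k, codes.map e = exponentRow (2 ^ k - 1) (2 ^ k - 1) 0 0 0 0 0) ∨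
      2 ^ n 2 < 512 ∧ 2 ^ n 3 < 512 ∧ 2 ^ n 7 < 512 := by
  have g2 := (h.general 2 (by simp)).2
  have g3 := (h.general 3 (by simp)).2
  have g7 := (h.general 7 (by simp)).2
  have z11 : e 11 = 0 := by
    rw [h.eq11]; rcases h2 with h2 | h2 <;> rcases h3 with h3 | h3 <;> simp [h2, h3, h7, gate]
  have z13 : e 13 = 0 := by rw [h.eq13, ← h.eq11, z11]
  have z109 : e 109 = 0 := by rw [h.eq109]; simp [h7, gate]
  obtain ⟨u11, p11⟩ := h.eq_one_of_zero (by simp) z11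
  obtain ⟨u13, p13⟩ := h.eq_one_of_zero (by simp) z13
  obtain ⟨u109, p109⟩ := h.eq_one_of_zero (by simp) z109
  have z361 : e 361 = 0 := by rw [h.eq361]; simp [h7, gate]
  have z379 : e 379 = 0 := by rw [h.eq379]; simp [h7, gate, u109]
  have z19 : e 19 = 0 := by
    rw [h.eq19]
    rcases h2 with h2 | h2 <;> rcases h3 with h3 | h3 <;> simp [h2, h3, h7, gate, u109]
  obtain ⟨u19, p19⟩ := h.eq_one_of_zero (by simp) z19
  have z31 : e 31 = 0 := by
    rw [h.eq31]
    rcases h2 with h2 | h2 <;> rcases h3 with h3 | h3 <;> simp [h2, h3, h7, gate, u13, u19]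
  have z25 : e 25 = 0 := by
    rw [h.eq25]
    rcases h2 with h2 | h2 <;> rcases h3 with h3 | h3 <;> simp [h2, h3, h7, gate, u11, u19]
  have z8191 : e 8191 = 0 := by rw [h.eq8191]; rcases h2 with h2 | h2 <;> simp [h2, gate]
  have z73 : e 73 = 0 := by rw [h.eq73]; rcases h2 with h2 | h2 <;> simp [h2, gate]
  have z91 : e 91 = 0 := by rw [h.eq91]; rcases h3 with h2 | h2 <;> simp [h2, gate]
  have z6553 : e 6553 = 0 := by rw [h.eq6553]; rcases h3 with h2 | h2 <;> simp [h2, gate]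
  have eq2 : e 2 = 2 ^ n 3 - 1 + (2 ^ n 7 - 1) := by
    rw [h.eq2]; simp [*]
  have eq3 : e 3 = 2 ^ n 2 - 1 + (2 ^ n 7 - 1) := by
    rw [h.eq3]; simp [*]
  have eq7 : e 7 = gate [3, 9, 15] (u 2) (2 ^ n 2) + gate [3, 9, 15] (u 3) (2 ^ n 3) := by
    rw [h.eq7]; simp [z8191, z73, z91, z6553, z379, z361, p19, p109, u11, u13, gate]
  have px := Nat.one_le_two_pow (n := n 2)
  have py := Nat.one_le_two_pow (n := n 3)
  have pm := Nat.one_le_two_pow (n := n 7)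
  by_cases h0 : u 2 = 1 ∧ u 3 = 1
  · have z7 : e 7 = 0 := by rw [eq7]; simp [h0, gate]
    have p7 : 2 ^ n 7 = 1 := by rw [z7, h7] at g7; omega
    rw [h0.1] at g2
    left
    refine ⟨n 3, ?_⟩
    rw [h.map_codes_of_small h2 h3 z7 z11 z13 z31 z25 z19 z109 z379 z361]
    congr 1 <;> omega
  · right
    refine lt_of_pow_eqs (s := u 2) (t := u 3) (eq_one_or_even _) (eq_one_or_even _)
      (eq_one_or_even _) (by omega) (by omega) py ?_
    rw [h7, eq7, mul_one] at g7
    rw [← g7]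
    rcases h2 with h2 | h2 <;> rcases h3 with h3 | h3 <;> simp [h2, h3, gate] at h0 ⊢

/-- If both linear polynomials had u = 1, their two equations would bound 2^(n 2) and 2^(n 3) by
each other, so all other terms vanish. Each value u ≠ 1 for M1 then makes the exponent of S1, S2 or
S8 equal to 1, contradicting this. -/
theorem ne_one_of_ne_one (h : System e n u) (h7 : u 7 ≠ 1) : ¬ (u 2 = 1 ∧ u 3 = 1) := by
  rintro ⟨h2, h3⟩
  have g2 := (h.general 2 (by simp)).2
  have g3 := (h.general 3 (by simp)).2
  have px := Nat.one_le_two_pow (n := n 2)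
  have py := Nat.one_le_two_pow (n := n 3)
  have pm := Nat.one_le_two_pow (n := n 7)
  have eq2 := h.eq2
  have eq3 := h.eq3
  rw [h2] at g2
  rw [h3] at g3
  have p7 : 2 ^ n 7 = 1 := by omega
  have p19 : 2 ^ n 19 = 1 := by
    have := Nat.one_le_two_pow (n := n 19)
    omega
  have p109 : 2 ^ n 109 = 1 := by
    have := Nat.one_le_two_pow (n := n 109)
    omega
  have z361 : e 361 = 0 := by omega
  have e19 := h.eq19
  have e109 := h.eq109
  have g19 := (h.general 19 (by simp)).2
  have g109 := (h.general 109 (by simp)).2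
  have o19 := h.options19
  have o109 := h.options109
  rw [p19] at g19
  rw [p109] at g109
  rw [h.eq361, p7] at z361
  have h0 := h.options7
  simp only [List.mem_cons, List.not_mem_nil, or_false] at h0 o19 o109
  clear eq2 eq3 g2 g3
  rcases h0 with h0 | h0 | h0 | h0 | h0
  · exact h7 h0
  · rw [show e 109 = 0 by rw [e109]; simp [h0, gate]] at g109
    have : e 19 = 1 := by
      rw [e19]
      simp [h0, h2, h3, p7, gate, show u 109 = 1 by omega]
    omega
  · simp [h0, gate] at z361
  · have : e 109 = 1 := by rw [e109]; simp [h0, p7, gate]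
    omega
  · simp [h0, gate] at z361

/-- If a linear polynomial has u ≠ 1, 3, then 2^n u ≤ 31 · 15 = 465 bounds the other two powers.
Otherwise, if u ≠ 1 for M1, its 2^n u ≤ 47 · 3 = 141 bounds the power for a linear polynomial with u
= 3 by 140, and the other by 3 · 140. All are below 512. -/
theorem trivial_or_bounded (h : System e n u) :
    (∃ k, codes.map e = exponentRow (2 ^ k - 1) (2 ^ k - 1) 0 0 0 0 0) ∨
      2 ^ n 2 < 512 ∧ 2 ^ n 3 < 512 ∧ 2 ^ n 7 < 512 := by
  have hx := h.le_mul2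
  have hy := h.le_mul3
  have hm := h.le_mul7
  have px := Nat.one_le_two_pow (n := n 2)
  have py := Nat.one_le_two_pow (n := n 3)
  have pm := Nat.one_le_two_pow (n := n 7)
  by_cases h2 : u 2 = 1 ∨ u 2 = 3
  swap
  · right
    have h1 := h.lt_linearBound2 (by tauto) (by tauto)
    have h0 := h.options2
    simp only [List.mem_cons, List.not_mem_nil, or_false] at h0
    rcases h0 with h0 | h0 | h0 | h0 | h0 | h0 | h0 <;> simp [h0, linearBound] at h1 h2 hx <;> omega
  by_cases h3 : u 3 = 1 ∨ u 3 = 3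
  swap
  · right
    have h1 := h.lt_linearBound3 (by tauto) (by tauto)
    have h0 := h.options3
    simp only [List.mem_cons, List.not_mem_nil, or_false] at h0
    rcases h0 with h0 | h0 | h0 | h0 | h0 | h0 | h0 <;> simp [h0, linearBound] at h1 h3 hy <;> omega
  by_cases h7 : u 7 = 1
  · exact h.trivial_or_bounded_of_one h2 h3 h7
  · have h1 := h.lt_quadraticBound h7
    have h4 := h.ne_one_of_ne_one h7
    have h0 := h.options7
    simp only [List.mem_cons, List.not_mem_nil, or_false] at h0
    right
    rcases h2 with h2 | h2 <;> rcases h3 with h3 | h3 <;> rcases h0 with h0 | h0 | h0 | h0 | h0 <;>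
      simp [h0, h2, h3, quadraticBound, gate] at h1 hx hy hm h4 h7 <;> omega

end System

/-! ### The finite search -/

/-- The exponents of a polynomial in terms of `2 ^ n` and `u` for its factors `x`, `x + 1`, `M1`,
`S2`, `M2` (and `M3`), `S1`, listed in the order of the codes. -/
def exponentList (x ux y uy m um t ut a ua s us : ℕ) : List ℕ :=
  [x * ux - 1, y * uy - 1, m * um - 1, a * ua - 1, a * ua - 1,
    gate [5, 15] ux x + gate [15] uy y + gate [15] um m + gate [3] ua a + gate [3] us s,
    gate [15] ux x + gate [5, 15] uy y + gate [15] um m + gate [3] ua a + gate [3] us s,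
    0, 0, 0, 0, 0, 0, 0, 0, s * us - 1, t * ut - 1,
    gate [13] ux x, gate [9] ux x, gate [9] uy y, gate [13] uy y,
    gate [15] um m + gate [3] ut t, gate [5, 15] um m, 0, 0, 0, 0, 0, 0, 0]

/-- The exponents of the known perfect polynomials. -/
def solutions : List (List ℕ) :=
  [exponentRow 2 1 1 0 0 0 0, exponentRow 1 2 1 0 0 0 0, exponentRow 4 3 0 0 1 0 0,
    exponentRow 3 4 0 0 0 1 0, exponentRow 4 4 0 0 1 1 0, exponentRow 6 3 0 1 0 0 0,
    exponentRow 3 6 0 1 0 0 0, exponentRow 4 6 0 1 1 0 0, exponentRow 6 4 0 1 0 1 0,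
    exponentRow 2 1 2 0 0 0 1, exponentRow 1 2 2 0 0 0 1]

/-- The exponents of `(x * (x + 1)) ^ (2 ^ k - 1)` for `k < 9`. -/
def smallTrivial : List (List ℕ) :=
  [1, 2, 4, 8, 16, 32, 64, 128, 256].map fun p => exponentRow (p - 1) (p - 1) 0 0 0 0 0

/-- The equations for the exponents of `x`, `x + 1` and `M1`, given the list of all exponents and
the numbers `2 ^ n - 1` for `x`, `x + 1`, `M1`, `S2`, `M2` and `S1`. -/
def checkList (x ux y uy m t a ua s : ℕ) : List ℕ → Bool
  | [e2, e3, e7, _, _, e31, e25, _, _, _, _, _, _, _, _, _, _, e8191, e73, e91, e6553, e379, e361,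
      _, _, _, _, _, _, _] =>
    (e2 == y - 1 + (m - 1) + (a - 1) + (a - 1) * 2 + e31 + e25 * 3 + (s - 1) + (t - 1) * 2 + e8191 +
      e73 * 3 + e91 + e6553 * 3 + e379 + e361 * 3) &&
    ((e3 == x - 1 + (m - 1) + (a - 1) * 2 + (a - 1) + e31 * 3 + e25 + (s - 1) + (t - 1) * 2 +
      e8191 * 3 + e73 + e91 * 3 + e6553 + e379 + e361 * 3) &&
    ((e7 == gate [3, 9, 15] ux x + gate [3, 9, 15] uy y + gate [3] ua a + gate [3] ua a + (s - 1) +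
      (t - 1) + e8191 * 4 + e73 + e91 + e6553 * 4 + e379 * 3 + e361) &&
    [e31, e25, e8191, e73, e91, e6553, e379, e361].all fun k => twoPart (k + 1) == k + 1))
  | _ => false

/-- The exponents determined by `2 ^ n` and `u` for `x`, `x + 1` and `M1`, if consistent, are those
of a known perfect polynomial. -/
def boxTest (x ux y uy m um t a : ℕ) : Bool :=
  let s := gate [15] ux x + gate [15] uy y + gate [3, 15] um m + gate [3] (t / twoPart t) (twoPart t) + 1
  let l := exponentList x ux y uy m um (twoPart t) (t / twoPart t) (twoPart a) (a / twoPart a)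
    (twoPart s) (s / twoPart s)
  !(checkList x ux y uy m (twoPart t) (twoPart a) (a / twoPart a) (twoPart s) l) ||
    decide (l ∈ solutions ∨ l ∈ smallTrivial)

/-- The possible pairs of `2 ^ n < 512` and `u` for a linear polynomial. -/
def linearBox : List (ℕ × ℕ) :=
  [(1, 1), (2, 1), (4, 1), (8, 1), (16, 1), (32, 1), (64, 1), (128, 1), (256, 1),
    (1, 3), (2, 3), (4, 3), (8, 3), (16, 3), (32, 3), (64, 3), (128, 3), (256, 3),
    (1, 5), (2, 5), (4, 5), (8, 5), (16, 5), (1, 7), (2, 7), (4, 7), (8, 7), (16, 7),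
    (1, 9), (1, 13), (1, 15), (2, 15), (4, 15), (8, 15), (16, 15)]

/-- The possible pairs of `2 ^ n < 512` and `u` for `M1`. -/
def quadraticBox : List (ℕ × ℕ) :=
  [(1, 1), (2, 1), (4, 1), (8, 1), (16, 1), (32, 1), (64, 1), (128, 1), (256, 1),
    (1, 3), (2, 3), (4, 3), (8, 3), (16, 3), (32, 3), (1, 5), (1, 7), (2, 7), (4, 7), (1, 15)]

/-- The pairs for x, x + 1 and M1 determine the exponents of S2, M2 and M3, then that of S1, then
all others. The last two arguments of `boxTest` are exponents plus one, split by `twoPart` into 2^n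
and u. The leading comparisons prune by `System.le_mul2` and `System.le_mul3`. -/
theorem boxTest_box : (linearBox.all fun q => linearBox.all fun r =>
    Nat.blt (q.1 * q.2) r.1 || (Nat.blt (r.1 * r.2) q.1 || quadraticBox.all fun w =>
      Nat.blt (q.1 * q.2 + 1) (r.1 + w.1) || boxTest q.1 q.2 r.1 r.2 w.1 w.2 (gate [7] w.2 w.1 + 1)
        (gate [7] q.2 q.1 + gate [7] r.2 r.1 + gate [7] w.2 w.1 + 1))) = true := by
  decide +kernel

theorem mem_linearBox {k u : ℕ} (hk : 2 ^ k < 512) (hu : u ∈ [1, 3, 5, 7, 9, 13, 15])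
    (h : u ≠ 1 → u ≠ 3 → 2 ^ k < System.linearBound u) : (2 ^ k, u) ∈ linearBox := by
  have h1 : ∀ k < 9, ∀ u ∈ [1, 3, 5, 7, 9, 13, 15],
      (u ≠ 1 → u ≠ 3 → 2 ^ k < System.linearBound u) → (2 ^ k, u) ∈ linearBox := by
    decide +kernel
  exact h1 k ((Nat.pow_lt_pow_iff_right one_lt_two).mp (hk.trans_eq (by norm_num : 512 = 2 ^ 9))) u hu h

theorem mem_quadraticBox {k u : ℕ} (hk : 2 ^ k < 512) (hu : u ∈ [1, 3, 5, 7, 15])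
    (h : u ≠ 1 → 2 ^ k < System.quadraticBound u) : (2 ^ k, u) ∈ quadraticBox := by
  have h1 : ∀ k < 9, ∀ u ∈ [1, 3, 5, 7, 15],
      (u ≠ 1 → 2 ^ k < System.quadraticBound u) → (2 ^ k, u) ∈ quadraticBox := by
    decide +kernel
  exact h1 k ((Nat.pow_lt_pow_iff_right one_lt_two).mp (hk.trans_eq (by norm_num : 512 = 2 ^ 9))) u hu h

namespace System

variable {e n u : ℕ → ℕ}

theorem twoPart_general (h : System e n u) {c : ℕ} (hc : c ∈ [11, 13, 19, 109]) (hn : n c ≤ 10) :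
    twoPart (e c + 1) = 2 ^ n c ∧ (e c + 1) / 2 ^ n c = u c := by
  have h1 : ∀ c ∈ [11, 13, 19, 109], c ∈ [2, 3, 7, 11, 13, 19, 109] ∧
      ∀ v ∈ options c, v % 2 = 1 := by decide
  obtain ⟨h2, h3⟩ := h.general c (h1 c hc).1
  refine ⟨twoPart_eq h3 hn (Nat.odd_iff.mpr ((h1 c hc).2 _ h2)), ?_⟩
  rw [h3, Nat.mul_div_cancel_left _ (by positivity)]

theorem twoPart_mersenne (h : System e n u) {c : ℕ}
    (hc : c ∈ [31, 25, 8191, 73, 91, 6553, 379, 361]) (hn : n c ≤ 10) :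
    twoPart (e c + 1) = e c + 1 := by
  have h1 := h.mersenne c hc
  rw [twoPart_eq (h1.trans (mul_one _).symm) hn odd_one, h1]

theorem map_codes (h : System e n u) : codes.map e ∈ solutions ∨
    ∃ k, codes.map e = exponentRow (2 ^ k - 1) (2 ^ k - 1) 0 0 0 0 0 := by
  rcases h.trivial_or_bounded with h0 | ⟨hx, hy, hm⟩
  · exact Or.inr h0
  have b := boxTest_box
  have b1 := List.all_eq_true.mp (List.all_eq_true.mp b _
    (mem_linearBox hx h.options2 h.lt_linearBound2)) _
    (mem_linearBox hy h.options3 h.lt_linearBound3)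
  have c1 : Nat.blt (2 ^ n 2 * u 2) (2 ^ n 3) = false := by
    rw [← Bool.not_eq_true, Nat.blt_eq]
    have := h.le_mul2
    omega
  have c2 : Nat.blt (2 ^ n 3 * u 3) (2 ^ n 2) = false := by
    rw [← Bool.not_eq_true, Nat.blt_eq]
    have := h.le_mul3
    omega
  have c3 : Nat.blt (2 ^ n 2 * u 2 + 1) (2 ^ n 3 + 2 ^ n 7) = false := by
    rw [← Bool.not_eq_true, Nat.blt_eq]
    have := h.le_mul2
    omega
  rw [c1, c2, Bool.false_or, Bool.false_or] at b1
  have b2 := List.all_eq_true.mp b1 _ (mem_quadraticBox hm h.options7 h.lt_quadraticBound)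
  simp only [c3, Bool.false_or] at b2
  obtain ⟨t1, t2⟩ := h.twoPart_general (c := 109) (by simp) (h.n109_le.trans (by norm_num))
  obtain ⟨a1, a2⟩ := h.twoPart_general (c := 11) (by simp) (h.n11_le.trans (by norm_num))
  obtain ⟨a3, a4⟩ := h.twoPart_general (c := 13) (by simp) (h.n13_le.trans (by norm_num))
  obtain ⟨s1, s2⟩ := h.twoPart_general (c := 19) (by simp) (h.n19_le.trans (by norm_num))
  -- M2 and M3 satisfy the same equation, so a single pair describes both.
  have e1113 : e 13 = e 11 := h.eq13.trans h.eq11.symm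
  have n1113 : 2 ^ n 13 = 2 ^ n 11 := by rw [← a3, ← a1, e1113]
  have u1113 : u 13 = u 11 := by rw [← a4, ← a2, e1113, n1113]
  have g2 := (h.general 2 (by simp)).2
  have g3 := (h.general 3 (by simp)).2
  have g7 := (h.general 7 (by simp)).2
  have g11 := (h.general 11 (by simp)).2
  have g19 := (h.general 19 (by simp)).2
  have g109 := (h.general 109 (by simp)).2
  have habs := h.absent
  simp only [List.forall_mem_cons] at habs
  have hl : exponentList (2 ^ n 2) (u 2) (2 ^ n 3) (u 3) (2 ^ n 7) (u 7) (2 ^ n 109) (u 109)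
      (2 ^ n 11) (u 11) (2 ^ n 19) (u 19) = codes.map e := by
    simp [exponentList, codes, ← g2, ← g3, ← g7, ← g11, ← g19, ← g109, habs, e1113, h.eq31, h.eq25,
      h.eq8191, h.eq73, h.eq91, h.eq6553, h.eq379, h.eq361, u1113, n1113]
  have hc : checkList (2 ^ n 2) (u 2) (2 ^ n 3) (u 3) (2 ^ n 7) (2 ^ n 109) (2 ^ n 11) (u 11)
      (2 ^ n 19) (codes.map e) = true := by
    have m1 := h.twoPart_mersenne (c := 31) (by simp) (h.n31_le.trans (by norm_num))
    have m2 := h.twoPart_mersenne (c := 25) (by simp) (h.n25_le.trans (by norm_num))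
    have m3 := h.twoPart_mersenne (c := 8191) (by simp) (h.n8191_le.trans (by norm_num))
    have m4 := h.twoPart_mersenne (c := 73) (by simp) (h.n73_le.trans (by norm_num))
    have m5 := h.twoPart_mersenne (c := 91) (by simp) (h.n91_le.trans (by norm_num))
    have m6 := h.twoPart_mersenne (c := 6553) (by simp) (h.n6553_le.trans (by norm_num))
    have m7 := h.twoPart_mersenne (c := 379) (by simp) (h.n379_le.trans (by norm_num))
    have m8 := h.twoPart_mersenne (c := 361) (by simp) (h.n361_le.trans (by norm_num))
    have q2 := h.eq2
    have q3 := h.eq3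
    have q7 := h.eq7
    rw [n1113] at q2 q3
    rw [n1113, u1113] at q7
    simp only [codes, List.map_cons, List.map_nil, checkList, Bool.and_eq_true, beq_iff_eq,
      List.all_cons, List.all_nil, and_true]
    exact ⟨q2, q3, q7, m1, m2, m3, m4, m5, m6, m7, m8⟩
  rw [h.eq109] at t1 t2
  rw [h.eq11] at a1 a2
  rw [h.eq19] at s1 s2
  simp only [boxTest, t1, t2, a1, a2, s1, s2, hl, hc, Bool.not_true, Bool.false_or,
    decide_eq_true_eq] at b2
  refine b2.imp_right fun hmem => ?_
  simp only [smallTrivial, List.mem_map] at hmem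
  obtain ⟨p, hp, hp'⟩ := hmem
  have h1 : ∀ p ∈ [1, 2, 4, 8, 16, 32, 64, 128, 256], p = 2 ^ p.log2 := by decide +kernel
  exact ⟨p.log2, by rw [← h1 p hp, hp']⟩

end System

/-! ### From exponents back to polynomials -/

/-- The code of a power. -/
def powBits (a k : ℕ) : ℕ := (List.replicate k a).foldr mulBits 1

theorem ofBits_pow (a k : ℕ) : ofBits a ^ k = ofBits (powBits a k) := by
  rw [powBits, ofBits_foldr, List.map_replicate, List.prod_replicate]

theorem x_eq_ofBits : x = ofBits 2 := ofBits_two.symm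

theorem x_add_one_eq_ofBits : x + 1 = ofBits 3 := ofBits_three.symm

theorem bar_ofBits (a : ℕ) : bar (ofBits a) = ofBits (compBits a 3) := by
  rw [bar, x_add_one_eq_ofBits, ofBits_compBits]

theorem exists_code_of_mem_family {P : (ZMod 2)[X]} (hP : P ∈ family) :
    ∃ c ∈ codes, ofBits c = P := by
  rcases hP with hP | hP
  · simp only [family1, Set.mem_insert_iff, Set.mem_singleton_iff, M1, M2, M3, M4, M5, M6, M7, M8,
      M9, M10, M11, M12, M13, x_eq_ofBits, ← ofBits_one, ← ofBits_xor, ofBits_pow,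
      bar_ofBits] at hP
    rcases hP with hP | hP | hP | hP | hP | hP | hP | hP | hP | hP | hP | hP | hP <;>
      exact ⟨_, by decide +kernel, hP.symm⟩
  · simp only [family2, Set.mem_insert_iff, Set.mem_singleton_iff, S1, S2, S3, S4, S5, S6, S7, S8,
      S9, S10, S11, S12, S13, S14, S15, angle, M1, x_eq_ofBits, ← ofBits_one, ← ofBits_xor,
      ofBits_pow, ← ofBits_mulBits] at hP
    rcases hP with hP | hP | hP | hP | hP | hP | hP | hP | hP | hP | hP | hP | hP | hP | hP <;>
      exact ⟨_, by decide +kernel, hP.symm⟩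

theorem eq_of_irreducible_of_isEven {P : (ZMod 2)[X]} (hP : Irreducible P) (he : IsEven P) :
    P = ofBits 2 ∨ P = ofBits 3 := by
  obtain ⟨L, hL, hLP⟩ := he
  have hLu : ¬ IsUnit L := by
    intro h
    rw [isUnit_iff_eq_one.mp h, degree_one] at hL
    exact zero_ne_one hL
  obtain rfl := eq_of_associated ((hP.dvd_iff.mp hLP).resolve_left hLu)
  obtain ⟨m, rfl⟩ := ofBits_surjective P
  have h1 := natDegree_eq_of_degree_eq_some hL
  rw [natDegree_ofBits] at h1
  have h0 : m ≠ 0 := by rintro rfl; simp at h1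
  obtain ⟨h2, h3⟩ := (Nat.log2_eq_iff h0).mp h1
  norm_num at h2 h3
  rcases (show m = 2 ∨ m = 3 by omega) with rfl | rfl
  · exact Or.inl rfl
  · exact Or.inr rfl

theorem smooth_of_forall_mem_family {A : (ZMod 2)[X]}
    (hA : ∀ P : (ZMod 2)[X], Irreducible P → P ∣ A → IsOdd P → P ∈ family) : Smooth A := by
  intro P hP hd
  by_cases he : IsEven P
  · rcases eq_of_irreducible_of_isEven hP he with rfl | rfl
    · exact ⟨2, by decide, rfl⟩
    · exact ⟨3, by decide, rfl⟩
  · exact exists_code_of_mem_family (hA P hP hd he)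

/-- The code of the polynomial with the given list of exponents. -/
def prodBits (l : List ℕ) : ℕ := ((codes.zip l).map fun q => powBits q.1 q.2).foldr mulBits 1

theorem ofBits_prodBits_map (e : ℕ → ℕ) :
    ofBits (prodBits (codes.map e)) = ∏ c ∈ codes.toFinset, ofBits c ^ e c := by
  have h : ∀ l : List ℕ, l.zip (l.map e) = l.map fun c => (c, e c) := by
    intro l
    induction l with
    | nil => rfl
    | cons a l ih => simp [ih]
  rw [prodBits, ofBits_foldr, h, List.map_map, List.map_map, List.prod_toFinset _ codes_nodup]
  congr 1
  exact List.map_congr_left fun c _ => (ofBits_pow c (e c)).symm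

/-- The codes of the known perfect polynomials. -/
def knownCodes : List ℕ :=
  [36, 54, 2640, 3144, 67184, 41280, 52632, 1157904, 1098176, 3780, 2470]

theorem mem_knownPerfects_iff {A : (ZMod 2)[X]} :
    A ∈ knownPerfects ↔ ∃ k ∈ knownCodes, A = ofBits k := by
  have e1 : T1 = ofBits 36 := by
    simp only [T1, M1, x_eq_ofBits, ← ofBits_one, ← ofBits_xor, ofBits_pow, ← ofBits_mulBits]
    exact congrArg ofBits (by decide +kernel)
  have e3 : T3 = ofBits 2640 := by
    simp only [T3, M4, x_eq_ofBits, ← ofBits_one, ← ofBits_xor, ofBits_pow, ← ofBits_mulBits]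
    exact congrArg ofBits (by decide +kernel)
  have e5 : T5 = ofBits 67184 := by
    simp only [T5, M4, x_eq_ofBits, ← ofBits_one, ← ofBits_xor, ofBits_pow, bar_ofBits,
      ← ofBits_mulBits]
    exact congrArg ofBits (by decide +kernel)
  have e6 : T6 = ofBits 41280 := by
    simp only [T6, M2, x_eq_ofBits, ← ofBits_one, ← ofBits_xor, ofBits_pow, bar_ofBits,
      ← ofBits_mulBits]
    exact congrArg ofBits (by decide +kernel)
  have e8 : T8 = ofBits 1157904 := by
    simp only [T8, M2, M4, x_eq_ofBits, ← ofBits_one, ← ofBits_xor, ofBits_pow, bar_ofBits,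
      ← ofBits_mulBits]
    exact congrArg ofBits (by decide +kernel)
  have e10 : T10 = ofBits 3780 := by
    simp only [T10, M1, x_eq_ofBits, ← ofBits_one, ← ofBits_xor, ofBits_pow, ← ofBits_mulBits]
    exact congrArg ofBits (by decide +kernel)
  have e2 : T2 = ofBits 54 := by
    rw [T2, e1, bar_ofBits]; exact congrArg ofBits (by decide +kernel)
  have e4 : T4 = ofBits 3144 := by
    rw [T4, e3, bar_ofBits]; exact congrArg ofBits (by decide +kernel)
  have e7 : T7 = ofBits 52632 := by
    rw [T7, e6, bar_ofBits]; exact congrArg ofBits (by decide +kernel)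
  have e9 : T9 = ofBits 1098176 := by
    rw [T9, e8, bar_ofBits]; exact congrArg ofBits (by decide +kernel)
  have e11 : T11 = ofBits 2470 := by
    rw [T11, e10, bar_ofBits]; exact congrArg ofBits (by decide +kernel)
  simp only [knownPerfects, knownCodes, Set.mem_insert_iff, Set.mem_singleton_iff, e1, e2, e3, e4,
    e5, e6, e7, e8, e9, e10, e11, List.mem_cons, List.not_mem_nil, or_false, exists_eq_or_imp,
    exists_eq_left]

theorem map_prodBits_solutions : solutions.map prodBits = knownCodes := by decide +kernel

/-- This makes the condition on the conjugate of A in the final statement automatic. -/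
theorem bar_mem_knownPerfects {A : (ZMod 2)[X]} (hA : A ∈ knownPerfects) :
    bar A ∈ knownPerfects := by
  have h : ∀ k ∈ knownCodes, compBits k 3 ∈ knownCodes := by decide +kernel
  obtain ⟨k, hk, rfl⟩ := mem_knownPerfects_iff.mp hA
  exact mem_knownPerfects_iff.mpr ⟨_, h k hk, bar_ofBits k⟩

theorem knownPerfects_isPerfect {A : (ZMod 2)[X]} (hA : A ∈ knownPerfects) : IsPerfect A := by
  obtain ⟨k, hk, rfl⟩ := mem_knownPerfects_iff.mp hA
  have h0 : ∀ k ∈ knownCodes, k ≠ 0 := by decide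
  refine ⟨mt ofBits_eq_zero.mp (h0 k hk), ?_⟩
  rw [← map_prodBits_solutions, List.mem_map] at hk
  obtain ⟨l, hl, rfl⟩ := hk
  -- The second part is σ(A) = A on codes: the product of the geometric sums of length e + 1 is
  -- compared with the product of the powers.
  have h1 : ∀ l ∈ solutions, codes.map (fun c => l.getD (codes.idxOf c) 0) = l ∧
      (codes.map fun c => compBits (2 ^ (l.getD (codes.idxOf c) 0 + 1) - 1) c).foldr mulBits 1
        = prodBits l := by
    decide +kernel
  obtain ⟨h2, h3⟩ := h1 l hl
  rw [← h3]
  conv_lhs => rw [h3, ← h2, ofBits_prodBits_map]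
  rw [sigma_prod _ fun c hc => List.mem_toFinset.mp hc, ofBits_foldr, List.map_map,
    List.prod_toFinset _ codes_nodup]
  congr 1
  refine List.map_congr_left fun c _ => ?_
  rw [Function.comp_apply, ofBits_compBits, ofBits_two_pow_sub_one, geom_X_comp]

/-! ### Classification and indecomposability -/

/-- The perfect polynomials all of whose irreducible divisors are given by the codes. -/
theorem IsPerfect.mem_knownPerfects_or {A : (ZMod 2)[X]} (hA : IsPerfect A) (hs : Smooth A) :
    A ∈ knownPerfects ∨ ∃ m, A = ofBits 2 ^ m * ofBits 3 ^ m := by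
  obtain ⟨n, u, h⟩ := exponent_system hA hs
  have hprod := hs.eq_prod hA.1
  rw [← ofBits_prodBits_map] at hprod
  rcases (system_of_exponents h).map_codes with h1 | ⟨k, h1⟩
  · left
    rw [mem_knownPerfects_iff, ← map_prodBits_solutions]
    exact ⟨_, List.mem_map_of_mem h1, hprod⟩
  · right
    refine ⟨2 ^ k - 1, ?_⟩
    rw [hprod, h1, prodBits, ofBits_foldr]
    simp [codes, exponentRow, ← ofBits_pow]

/-- This removes the infinite family from the classification of nonsplitting polynomials. -/
theorem isSplitting_of_eq {A : (ZMod 2)[X]} {m : ℕ} (hA : A = ofBits 2 ^ m * ofBits 3 ^ m)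
    (he : IsEven A) : IsSplitting A := by
  refine ⟨he, ?_⟩
  have hsub : {P : (ZMod 2)[X] | Irreducible P ∧ P ∣ A} ⊆ {ofBits 2, ofBits 3} := by
    rintro P ⟨hP, hd⟩
    have h : ∀ c ∈ codes, P ∣ ofBits c → P = ofBits c := fun c hc h =>
      eq_of_associated (hP.associated_of_dvd (irreducible_of_mem_codes hc) h)
    rw [hA] at hd
    rcases hP.prime.dvd_or_dvd hd with h1 | h1
    · exact Or.inl (h 2 (by decide) (hP.prime.dvd_of_dvd_pow h1))
    · exact Or.inr (h 3 (by decide) (hP.prime.dvd_of_dvd_pow h1))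
  exact (Set.ncard_le_ncard hsub (Set.toFinite _)).trans ((Set.ncard_insert_le _ _).trans (by simp))

/-- A common divisor x of all nonconstant perfect candidates rules out any coprime decomposition. -/
theorem IsPerfect.dvd_of_smooth {A : (ZMod 2)[X]} (hA : IsPerfect A) (hs : Smooth A)
    (hdeg : 0 < A.natDegree) : ofBits 2 ∣ A := by
  rcases hA.mem_knownPerfects_or hs with h | ⟨m, rfl⟩
  · obtain ⟨k, hk, rfl⟩ := mem_knownPerfects_iff.mp h
    have h1 : ∀ k ∈ knownCodes, modBits k 2 = 0 := by decide +kernel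
    exact dvd_of_modBits_eq_zero (h1 k hk)
  · have hm : m ≠ 0 := by rintro rfl; simp at hdeg
    exact (dvd_pow_self _ hm).mul_right _

theorem IsPerfect.isIndecomposablePerfect {A : (ZMod 2)[X]} (hA : IsPerfect A) (hs : Smooth A) :
    IsIndecomposablePerfect A := by
  refine ⟨hA, ?_⟩
  rintro ⟨B, C, hB, hC, hB0, hC0, hBC, rfl⟩
  exact (irreducible_of_mem_codes (c := 2) (by decide)).not_isUnit
    (hBC.isUnit_of_dvd' (hB.dvd_of_smooth (hs.of_dvd (dvd_mul_right B C)) hB0)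
      (hC.dvd_of_smooth (hs.of_dvd (dvd_mul_left C B)) hC0))

end BinaryPoly

theorem theorem1 (A : (ZMod 2)[X]) (hA0 : A ≠ 0) (hAeven : BinaryPoly.IsEven A)
    (hAnonsplit : ¬ BinaryPoly.IsSplitting A)
    (hAfamily : ∀ P : (ZMod 2)[X], Irreducible P → P ∣ A → BinaryPoly.IsOdd P →
      P ∈ BinaryPoly.family) :
    BinaryPoly.IsIndecomposablePerfect A ↔
      A ∈ BinaryPoly.knownPerfects ∧ BinaryPoly.bar A ∈ BinaryPoly.knownPerfects := by
  have hs := BinaryPoly.smooth_of_forall_mem_family hAfamily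
  constructor
  · rintro ⟨hA, -⟩
    rcases hA.mem_knownPerfects_or hs with h | ⟨m, h⟩
    · exact ⟨h, BinaryPoly.bar_mem_knownPerfects h⟩
    · exact absurd (BinaryPoly.isSplitting_of_eq h hAeven) hAnonsplit
  · rintro ⟨h, -⟩
    exact (BinaryPoly.knownPerfects_isPerfect h).isIndecomposablePerfect hs
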